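/- Let $S^2$ be the unit sphere of $\mathbb{R}^3$ with its spherical distance (the length of the shorter great-circle arc between two points). A set $C\subset S^2$ is convex if it contains no pair of antipodes and contains, with any two points, the shorter great-circle arc joining them; a spherical convex body is a closed convex set with non-empty interior (relative to $S^2$). The hemisphere with center $m\in S^2$ is $H(m)=\{x\in S^2:\langle m,x\rangle\ge 0\}$; its boundary is the great circle $\{x\in S^2:\langle m,x\rangle=0\}$. A hemisphere $H$ supports a body $C$ at a boundary point $p$ of $C$ if $C\subset H$ and $p\in\mathrm{bd}(H)$, and it supports $C$ if it does so at some boundary point. If $G,H$ are different, non-opposite hemispheres, $G\cap H$ is a lune, and its thickness $\Delta(G\cap H)$ is the distance between the centers of the two semicircles $\mathrm{bd}(G)\cap H$ and $\mathrm{bd}(H)\cap G$ bounding it. For a hemisphere $K$ supporting $C$, $\mathrm{width}_K(C)$ is the minimum of the thicknesses of the lunes $K\cap K'$ over all hemispheres $K'\neq K$ supporting $C$. The thickness $\Delta(C)$ is the minimum of $\mathrm{width}_K(C)$ over all hemispheres $K$ supporting $C$. A body $R$ is reduced if $\Delta(Z)<\Delta(R)$ for every spherical convex body $Z\subset R$ with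 $Z\ne R$. For three different hemispheres $X,Y,Z$ with centers $x,y,z$ that support $C$, write $\prec XYZ$ if either the three bounding great circles have no common point and the spherical triangle $xyz$ is positively oriented, or these circles have a common point $c\in C$ and $x,y,z$ lie in this cyclic order, for the positive (counterclockwise, seen from outside the sphere at $c$) orientation, on the great circle bounding $H(c)$. For a boundary point $p$ of $C$, the right and the left supporting hemispheres of $C$ at $p$ are the hemispheres $H_r$ and $H_l$ supporting $C$ at $p$ such that every hemisphere $H$ supporting $C$ at $p$ satisfies $H=H_r$, or $H=H_l$, or $\prec H_rHH_l$. An extreme supporting hemisphere of $C$ is a hemisphere that is the right or the left supporting hemisphere of $C$ at some boundary point $p$ of $C$. Theorem. If $M$ is an extreme supporting hemisphere of a reduced spherical convex body $R\subset S^2$, then $\mathrm{width}_M(R)=\Delta(R)$. -/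

import Mathlib

open scoped RealInnerProductSpace

noncomputable section

namespace SphericalBody

/-- Euclidean three-space. -/
abbrev E3 : Type := EuclideanSpace ℝ (Fin 3)

/-- The unit sphere of Euclidean three-space, as a topological space of its own: interior, closure
and frontier of subsets are taken relative to the sphere. -/
abbrev S2 : Type := Metric.sphere (0 : E3) 1

/-- Spherical distance: the length of the shorter great-circle arc from `a` to `b`. -/
def sdist (a b : E3) : ℝ := InnerProductGeometry.angle a b

/-- The spherical arc joining `a` and `b` (used for points that are not antipodal). -/
def arc (a b : S2) : Set S2 :=
  {x | ∃ s t : ℝ, 0 ≤ s ∧ 0 ≤ t ∧ (x : E3) = s • (a : E3) + t • (b : E3)}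

/-- A spherically convex set: no pair of antipodes, and closed under joining by arcs. -/
def IsConvex (C : Set S2) : Prop :=
  (∀ a ∈ C, -a ∉ C) ∧ ∀ a ∈ C, ∀ b ∈ C, arc a b ⊆ C

/-- A spherical convex body: closed, convex, with non-empty interior. -/
def IsBody (C : Set S2) : Prop :=
  IsClosed C ∧ IsConvex C ∧ (interior C).Nonempty

/-- The hemisphere `H(m)` with center `m`. Hemispheres correspond bijectively to their centers,
and below they are given by their centers. -/
def hemisphere (m : S2) : Set S2 := {x | 0 ≤ ⟪(m : E3), (x : E3)⟫}

/-- The great circle bounding the hemisphere `H(m)`. -/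
def greatCircle (m : S2) : Set S2 := {x | ⟪(m : E3), (x : E3)⟫ = 0}

/-- The hemisphere `H(m)` supports `C` at the boundary point `p` of `C`. -/
def SupportsAt (C : Set S2) (m p : S2) : Prop :=
  p ∈ frontier C ∧ C ⊆ hemisphere m ∧ p ∈ greatCircle m

/-- The hemisphere `H(m)` supports `C`. -/
def Supports (C : Set S2) (m : S2) : Prop := ∃ p, SupportsAt C m p

/-- `H(g)` and `H(h)` are different and not opposite, so that `H(g) ∩ H(h)` is a lune. -/
def FormLune (g h : S2) : Prop := g ≠ h ∧ g ≠ -h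

/-- The semicircle `G/H` that bounds the lune `G ∩ H` and lies on the boundary of `G`,
where `G = H(g)` and `H = H(h)`. -/
def semicircle (g h : S2) : Set S2 := greatCircle g ∩ hemisphere h

/-- The center of the semicircle `G/H`, where `G = H(g)` and `H = H(h)`: the normalized orthogonal
projection of `h` to the plane of the great circle bounding `G`. -/
def semicircleCenter (g h : S2) : E3 :=
  ‖(h : E3) - ⟪(g : E3), (h : E3)⟫ • (g : E3)‖⁻¹ • ((h : E3) - ⟪(g : E3), (h : E3)⟫ • (g : E3))

/-- The thickness of the lune `H(g) ∩ H(h)`: the distance of the centers of the two semicircles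
that bound it. -/
def luneThickness (g h : S2) : ℝ := sdist (semicircleCenter g h) (semicircleCenter h g)

/-- The width of `C` determined by the supporting hemisphere `H(k)`: the minimum thickness of the
lunes `H(k) ∩ H(k')` over all hemispheres `H(k')` supporting `C`. -/
def width (C : Set S2) (k : S2) : ℝ :=
  sInf {t | ∃ k', Supports C k' ∧ FormLune k k' ∧ t = luneThickness k k'}

/-- The thickness of `C`: the minimum width over all supporting hemispheres. -/
def thickness (C : Set S2) : ℝ := sInf {w | ∃ k, Supports C k ∧ w = width C k}

/-- A reduced body: every different body contained in it has smaller thickness. -/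
def IsReduced (R : Set S2) : Prop :=
  IsBody R ∧ ∀ Z : Set S2, IsBody Z → Z ⊆ R → Z ≠ R → thickness Z < thickness R

/-- The cross product on Euclidean three-space. -/
def cross (a b : E3) : E3 := WithLp.toLp 2 (crossProduct a.ofLp b.ofLp)

/-- `x`, `y`, `z` are different points of the great circle bounding the hemisphere `H(c)`, and they
lie on it in this cyclic order for the positive (counterclockwise, seen from outside at `c`)
orientation: starting from `x` one meets `y`, and then `z`, within one turn. -/
def CircleOrder (c x y z : S2) : Prop :=
  x ∈ greatCircle c ∧ ∃ α β : ℝ, 0 < α ∧ α < β ∧ β < 2 * Real.pi ∧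
    (y : E3) = Real.cos α • (x : E3) + Real.sin α • cross c x ∧
    (z : E3) = Real.cos β • (x : E3) + Real.sin β • cross c x

/-- The relation `≺ X Y Z` for the different supporting hemispheres `X = H(x)`, `Y = H(y)`,
`Z = H(z)` of `C`. Either the three bounding great circles have no common point, and the spherical
triangle `xyz` is positively oriented; or they have a common point `c`, and `x`, `y`, `z` lie in this
order on the boundary of `H(c)`. In the second case the common points are two antipodes, of which
exactly one belongs to `C` if `C` is a body, and `c` is that one. -/
def Before (C : Set S2) (x y z : S2) : Prop :=
  (Supports C x ∧ Supports C y ∧ Supports C z) ∧ (x ≠ y ∧ y ≠ z ∧ z ≠ x) ∧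
  ((greatCircle x ∩ greatCircle y ∩ greatCircle z = ∅ ∧
      0 < ⟪(x : E3), cross (y : E3) (z : E3)⟫) ∨
    ∃ c ∈ C, c ∈ greatCircle x ∩ greatCircle y ∩ greatCircle z ∧ CircleOrder c x y z)

/-- `H(r)` and `H(l)` are the right and the left supporting hemispheres of `C` at `p`: they support
`C` at `p`, and every hemisphere supporting `C` at `p` is one of the two or lies strictly between
them. (They coincide only if no other hemisphere supports `C` at `p`.) -/
def IsExtremePairAt (C : Set S2) (p r l : S2) : Prop :=
  SupportsAt C r p ∧ SupportsAt C l p ∧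
    ∀ h, SupportsAt C h p → h = r ∨ h = l ∨ Before C r h l

/-- `H(m)` is the right supporting hemisphere of `C` at `p`. -/
def IsRightSupportingAt (C : Set S2) (m p : S2) : Prop := ∃ l, IsExtremePairAt C p m l

/-- `H(m)` is the left supporting hemisphere of `C` at `p`. -/
def IsLeftSupportingAt (C : Set S2) (m p : S2) : Prop := ∃ r, IsExtremePairAt C p r m

/-- `H(m)` is an extreme supporting hemisphere of `C`: the right or the left supporting hemisphere
of `C` at some boundary point. -/
def IsExtremeSupporting (C : Set S2) (m : S2) : Prop :=
  ∃ p, IsRightSupportingAt C m p ∨ IsLeftSupportingAt C m p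

end SphericalBody

end

/-! The argument takes place in the dual body R*, the set of unit vectors of `polar R`. A lune
bounded by two hemispheres has thickness π minus the distance of their centers, so the width at k is
π minus the largest distance from k to a point of R*, and the thickness of R is π - D with D the
diameter of R* (`exists_width_eq`, `exists_thickness_eq`). With κ = cos D, the claim is that an
extreme supporting hemisphere, whose center m is an extreme point of R*, has a point of R* at
distance D from m.

Reducedness says that adjoining an outside point to R* increases its diameter. Letting such points
tend to a boundary point k of R* produces, in the limit, a chord of R* of length D that is
perpendicular at its end a to a great circle supporting R* at both k and a (`exists_limit_lune`,
`exists_minimal_lune`).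

Suppose that all of R* is closer to m than D. For k = m the foot a then differs from m, so an edge
of R* starts at m, and D > π/2. Approaching m from the other side of this edge gives a second edge
(`exists_two_minimal_lunes`). Now take k = n on the boundary of R*, in the direction bisecting the
angle at m, and let yz be the resulting chord, with foot y. If y lies outside the angle, across m
from one of the edges, this chord is incompatible with the chord perpendicular to that edge
(`false_of_perpendicular_chords`). If y lies in the angle, the projections of y and z to the plane
orthogonal to m have non-negative inner product. Hence κ = ⟪z, y⟫ ≥ ⟪m, z⟫⟪m, y⟫, while both factors
lie in (κ, 1] with κ < 0, which makes the product exceed κ. -/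

namespace SphericalBody

open Filter Topology

/-! ### The dual cone of a body and the bipolar theorem -/

/-- The closed convex cone generated by the centers of the hemispheres that contain `C`. -/
def polar (C : Set S2) : Set E3 := {u | ∀ r ∈ C, 0 ≤ ⟪(r : E3), u⟫}

lemma add_mem_polar {C : Set S2} {u v : E3} (hu : u ∈ polar C) (hv : v ∈ polar C) :
    u + v ∈ polar C := fun r hr => by
  rw [inner_add_right]; exact add_nonneg (hu r hr) (hv r hr)

lemma smul_mem_polar {C : Set S2} {u : E3} {t : ℝ} (ht : 0 ≤ t) (hu : u ∈ polar C) :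
    t • u ∈ polar C := fun r hr => by
  rw [real_inner_smul_right]; exact mul_nonneg ht (hu r hr)

lemma isClosed_polar (C : Set S2) : IsClosed (polar C) := by
  have : polar C = ⋂ r ∈ C, {u : E3 | 0 ≤ ⟪(r : E3), u⟫} := by
    ext u; simp [polar]
  rw [this]
  exact isClosed_biInter fun r _ =>
    isClosed_le continuous_const (continuous_const.inner continuous_id)

lemma norm_coe_sphere (x : S2) : ‖(x : E3)‖ = 1 := by simp

lemma inner_self_sphere (x : S2) : ⟪(x : E3), (x : E3)⟫ = 1 := by
  rw [real_inner_self_eq_norm_sq, norm_coe_sphere]; norm_num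

/-- The point of the sphere in the direction of a non-zero vector. -/
noncomputable def direction (v : E3) (hv : v ≠ 0) : S2 :=
  ⟨‖v‖⁻¹ • v, by simp [norm_smul, inv_mul_cancel₀ (norm_ne_zero_iff.2 hv)]⟩

@[simp] lemma coe_direction (v : E3) (hv : v ≠ 0) :
    (direction v hv : E3) = ‖v‖⁻¹ • v := rfl

/-- An interior point can be moved a little in the direction of `-u` without leaving `C`, and this
lowers its inner product with `u` by a positive amount. -/
lemma inner_pos_of_mem_interior {C : Set S2} {r : S2} (hr : r ∈ interior C) {u : E3}
    (hu : u ∈ polar C) (hu0 : u ≠ 0) : 0 < ⟪(r : E3), u⟫ := by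
  have hr0 : (r : E3) ≠ 0 := by
    intro h; have := norm_coe_sphere r; rw [h] at this; simp at this
  have hcont : Tendsto (fun ε : ℝ => (r : E3) - ε • u) (𝓝 0) (𝓝 (r : E3)) := by
    have : Continuous (fun ε : ℝ => (r : E3) - ε • u) := by fun_prop
    simpa using this.tendsto 0
  have hn : Tendsto (fun ε : ℝ => ‖(r : E3) - ε • u‖⁻¹ • ((r : E3) - ε • u)) (𝓝 0)
      (𝓝 (r : E3)) := by
    have := (hcont.norm.inv₀ (norm_ne_zero_iff.2 hr0)).smul hcont
    simpa [norm_coe_sphere] using this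
  obtain ⟨δ, hδ, hball⟩ := Metric.mem_nhds_iff.1 (mem_interior_iff_mem_nhds.1 hr)
  have h1 := hn.eventually (Metric.ball_mem_nhds _ hδ)
  have h2 := hcont.eventually (isOpen_ne.mem_nhds hr0)
  have h3 : ∀ᶠ ε : ℝ in 𝓝[>] 0, 0 < ε := eventually_mem_nhdsWithin
  obtain ⟨ε, ⟨h1, h2⟩, h3⟩ :=
    (((h1.and h2).filter_mono (nhdsWithin_le_nhds (s := Set.Ioi 0))).and h3).exists
  have hmem : direction _ h2 ∈ C := hball (by
    rw [Metric.mem_ball, Subtype.dist_eq]; exact h1)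
  have := hu _ hmem
  rw [coe_direction, real_inner_smul_left] at this
  have h4 : 0 ≤ ⟪(r : E3) - ε • u, u⟫ :=
    nonneg_of_mul_nonneg_right this (inv_pos.2 (norm_pos_iff.2 h2))
  rw [inner_sub_left, real_inner_smul_left, real_inner_self_eq_norm_sq] at h4
  have : 0 < ε * ‖u‖ ^ 2 := mul_pos h3 (by positivity)
  linarith

lemma exists_interior_inner_pos {C : Set S2} (hC : IsBody C) :
    ∃ r ∈ C, r ∈ interior C ∧ ∀ u ∈ polar C, u ≠ 0 → 0 < ⟪(r : E3), u⟫ :=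
  let ⟨r, hr⟩ := hC.2.2
  ⟨r, interior_subset hr, hr, fun _ hu hu0 => inner_pos_of_mem_interior hr hu hu0⟩

/-- The dual cone of a body contains no line. -/
lemma neg_notMem_polar {C : Set S2} (hC : IsBody C) {u : E3} (hu : u ∈ polar C) (hu0 : u ≠ 0) :
    -u ∉ polar C := by
  obtain ⟨r, hr, -, h⟩ := exists_interior_inner_pos hC
  intro h'
  have := h' r hr
  rw [inner_neg_right] at this
  linarith [h u hu hu0]

lemma isCompact_of_isBody {C : Set S2} (hC : IsBody C) : IsCompact C :=
  hC.1.isCompact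

lemma normalized_add_mem {C : Set S2} (hC : IsConvex C) {a b : S2} (ha : a ∈ C) (hb : b ∈ C)
    {s t : ℝ} (hs : 0 ≤ s) (ht : 0 ≤ t) (h0 : s • (a : E3) + t • (b : E3) ≠ 0) :
    direction _ h0 ∈ C := by
  refine hC.2 a ha b hb ⟨‖s • (a : E3) + t • (b : E3)‖⁻¹ * s,
    ‖s • (a : E3) + t • (b : E3)‖⁻¹ * t, by positivity, by positivity, ?_⟩
  simp [smul_add, mul_smul]

/-- The cone over a body, as a proper cone. -/
noncomputable def coneOver (C : Set S2) (hC : IsBody C) : ProperCone ℝ E3 where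
  carrier := {v | ∃ t : ℝ, 0 ≤ t ∧ ∃ r ∈ C, v = t • (r : E3)}
  zero_mem' := by
    obtain ⟨r, hr⟩ := hC.2.2
    exact ⟨0, le_rfl, r, interior_subset hr, by simp⟩
  add_mem' := by
    rintro _ _ ⟨s, hs, a, ha, rfl⟩ ⟨t, ht, b, hb, rfl⟩
    by_cases h0 : s • (a : E3) + t • (b : E3) = 0
    · exact ⟨0, le_rfl, a, ha, by simp [h0]⟩
    · refine ⟨‖s • (a : E3) + t • (b : E3)‖, norm_nonneg _, _, normalized_add_mem hC.2.1 ha hb hs ht h0, ?_⟩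
      rw [coe_direction, smul_inv_smul₀ (norm_ne_zero_iff.2 h0)]
  smul_mem' := by
    rintro c _ ⟨t, ht, r, hr, rfl⟩
    exact ⟨c * t, mul_nonneg c.2 ht, r, hr, by rw [mul_smul]; rfl⟩
  isClosed' := by
    refine IsSeqClosed.isClosed fun v w hv hw => ?_
    choose t ht r hr hvr using hv
    obtain ⟨r', hr', φ, hφ, hlim⟩ := (isCompact_of_isBody hC).tendsto_subseq hr
    refine ⟨‖w‖, norm_nonneg _, r', hr', ?_⟩
    have hn : ∀ n, ‖v n‖ = t n := fun n => by
      rw [hvr, norm_smul, norm_coe_sphere, Real.norm_of_nonneg (ht n), mul_one]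
    have h1 := hw.comp hφ.tendsto_atTop
    have h2 : Tendsto (fun n => ((r (φ n) : S2) : E3)) atTop (𝓝 (r' : E3)) :=
      (continuous_subtype_val.tendsto r').comp hlim
    have h3 := h1.norm.smul h2
    refine tendsto_nhds_unique h1 (h3.congr fun n => ?_)
    simp only [Function.comp]
    rw [hn, ← hvr]

/-- The bipolar theorem for spherical convex bodies. -/
lemma direction_mem_of_inner_nonneg {C : Set S2} (hC : IsBody C) {c : E3} (hc0 : c ≠ 0)
    (hc : ∀ u ∈ polar C, 0 ≤ ⟪u, c⟫) : direction c hc0 ∈ C := by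
  have hmem : c ∈ coneOver C hC := by
    by_contra h
    obtain ⟨y, hy, hy'⟩ := (coneOver C hC).hyperplane_separation' h
    have hyp : y ∈ polar C := fun r hr => hy r ⟨1, zero_le_one, r, hr, by simp⟩
    have := hc y hyp
    rw [real_inner_comm] at this
    linarith
  obtain ⟨t, ht, r, hr, hcr⟩ := hmem
  have hn : ‖c‖ = t := by
    rw [hcr, norm_smul, norm_coe_sphere, Real.norm_of_nonneg ht, mul_one]
  have : direction c hc0 = r := by
    apply Subtype.ext
    rw [coe_direction, hn, hcr, inv_smul_smul₀]
    rintro rfl; simp at hcr; exact hc0 hcr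
  rwa [this]

lemma finrank_E3 : Module.finrank ℝ E3 = 3 := by simp

lemma exists_ne_zero_orthogonal (a b : E3) : ∃ c : E3, c ≠ 0 ∧ ⟪a, c⟫ = 0 ∧ ⟪b, c⟫ = 0 := by
  have h : Module.finrank ℝ (Submodule.span ℝ ({a, b} : Set E3)) < Module.finrank ℝ E3 := by
    have h1 := finrank_span_finset_le_card (R := ℝ) ({a, b} : Finset E3)
    have h2 : ({a, b} : Finset E3).card ≤ 2 := Finset.card_le_two
    rw [finrank_E3]
    simp only [Finset.coe_insert, Finset.coe_singleton] at h1
    change Module.finrank ℝ (Submodule.span ℝ ({a, b} : Set E3)) ≤ _ at h1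
    omega
  have hne : (Submodule.span ℝ ({a, b} : Set E3))ᗮ ≠ ⊥ := by
    intro h'
    rw [Submodule.orthogonal_eq_bot_iff] at h'
    rw [h', finrank_top] at h
    exact lt_irrefl _ h
  obtain ⟨c, hc, hc0⟩ := Submodule.exists_mem_ne_zero_of_ne_bot hne
  exact ⟨c, hc0, hc a (Submodule.subset_span (by simp)), hc b (Submodule.subset_span (by simp))⟩

/-- The dual cone of a body is not contained in a line. -/
lemma exists_mem_polar_ne_smul {C : Set S2} (hC : IsBody C) (k : E3) :
    ∃ u ∈ polar C, ∀ t : ℝ, u ≠ t • k := by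
  by_contra! h
  obtain ⟨c, hc0, hkc, -⟩ := exists_ne_zero_orthogonal k k
  have key : ∀ u ∈ polar C, ⟪u, c⟫ = 0 := fun u hu => by
    obtain ⟨t, rfl⟩ := h u hu
    rw [real_inner_smul_left, hkc, mul_zero]
  have h1 := direction_mem_of_inner_nonneg hC hc0 fun u hu => (key u hu).ge
  have h2 := direction_mem_of_inner_nonneg hC (neg_ne_zero.2 hc0) fun u hu => by
    rw [inner_neg_right, key u hu, neg_zero]
  refine hC.2.1.1 _ h1 ?_
  convert h2 using 1
  apply Subtype.ext
  simp

/-! ### Lunes, width and thickness as distances in the dual body -/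

lemma sphere_ne_zero (x : S2) : (x : E3) ≠ 0 := by
  intro h; have := norm_coe_sphere x; rw [h] at this; simp at this

lemma inner_le_one (x y : S2) : ⟪(x : E3), (y : E3)⟫ ≤ 1 := by
  have := real_inner_le_norm (x : E3) y
  simpa [norm_coe_sphere] using this

lemma neg_one_le_inner (x y : S2) : -1 ≤ ⟪(x : E3), (y : E3)⟫ := by
  have := neg_le_of_abs_le (abs_real_inner_le_norm (x : E3) y)
  simpa [norm_coe_sphere] using this

lemma inner_eq_one_iff (x y : S2) : ⟪(x : E3), (y : E3)⟫ = 1 ↔ x = y := by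
  rw [inner_eq_one_iff_of_norm_eq_one (norm_coe_sphere x) (norm_coe_sphere y), Subtype.ext_iff]

lemma inner_eq_neg_one_iff (x y : S2) : ⟪(x : E3), (y : E3)⟫ = -1 ↔ x = -y := by
  rw [← inner_eq_one_iff]
  simp [inner_neg_right, neg_eq_iff_eq_neg]

/-- The two semicircle centers are normalized projections whose inner product is `-c`, so their
angle is supplementary to that of the hemisphere centers. This turns minimal thickness into maximal
distance in the dual body. -/
lemma luneThickness_eq {g h : S2} (hgh : FormLune g h) :
    luneThickness g h = Real.pi - Real.arccos ⟪(g : E3), (h : E3)⟫ := by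
  set c := ⟪(g : E3), (h : E3)⟫ with hc
  have hc1 : c < 1 := lt_of_le_of_ne (inner_le_one g h) fun h' =>
    hgh.1 ((inner_eq_one_iff g h).1 h')
  have hc2 : -1 < c := lt_of_le_of_ne (neg_one_le_inner g h) fun h' =>
    hgh.2 ((inner_eq_neg_one_iff g h).1 h'.symm)
  have hpos : 0 < 1 - c ^ 2 := by nlinarith
  have hv : ‖(h : E3) - c • (g : E3)‖ ^ 2 = 1 - c ^ 2 := by
    rw [← real_inner_self_eq_norm_sq]
    simp only [inner_sub_left, inner_sub_right, real_inner_smul_left, real_inner_smul_right,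
      inner_self_sphere, real_inner_comm (g : E3) (h : E3), ← hc]
    ring
  have hw : ‖(g : E3) - c • (h : E3)‖ ^ 2 = 1 - c ^ 2 := by
    rw [← real_inner_self_eq_norm_sq]
    simp only [inner_sub_left, inner_sub_right, real_inner_smul_left, real_inner_smul_right,
      inner_self_sphere, ← hc]
    rw [real_inner_comm, ← hc]; ring
  have hvw : ⟪(h : E3) - c • (g : E3), (g : E3) - c • (h : E3)⟫ = -c * (1 - c ^ 2) := by
    simp only [inner_sub_left, inner_sub_right, real_inner_smul_left, real_inner_smul_right,
      inner_self_sphere, ← hc]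
    rw [real_inner_comm, ← hc]; ring
  have hv0 : 0 < ‖(h : E3) - c • (g : E3)‖ := by
    refine lt_of_le_of_ne (norm_nonneg _) fun h' => ?_
    rw [← h'] at hv; norm_num at hv; linarith
  have hw0 : 0 < ‖(g : E3) - c • (h : E3)‖ := by
    refine lt_of_le_of_ne (norm_nonneg _) fun h' => ?_
    rw [← h'] at hw; norm_num at hw; linarith
  have hnn : ‖(h : E3) - c • (g : E3)‖ * ‖(g : E3) - c • (h : E3)‖ = 1 - c ^ 2 := by
    have : ‖(h : E3) - c • (g : E3)‖ = ‖(g : E3) - c • (h : E3)‖ := by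
      rw [← sq_eq_sq₀ hv0.le hw0.le, hv, hw]
    rw [this, ← sq, hw]
  unfold luneThickness sdist semicircleCenter
  rw [real_inner_comm (g : E3) (h : E3), ← hc,
    InnerProductGeometry.angle_smul_left_of_pos _ _ (inv_pos.2 hv0),
    InnerProductGeometry.angle_smul_right_of_pos _ _ (inv_pos.2 hw0),
    InnerProductGeometry.angle, hvw, hnn, mul_div_cancel_right₀ _ hpos.ne', Real.arccos_neg]

lemma supportsAt_of_inner_eq_zero {C : Set S2} {v p : S2}
    (hv : (v : E3) ∈ polar C) (hp : p ∈ C) (h : ⟪(p : E3), (v : E3)⟫ = 0) : SupportsAt C v p := by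
  refine ⟨⟨subset_closure hp, fun hi => ?_⟩, fun r hr => ?_, ?_⟩
  · exact (inner_pos_of_mem_interior hi hv (sphere_ne_zero v)).ne' h
  · have := hv r hr
    rwa [real_inner_comm] at this
  · change ⟪(v : E3), (p : E3)⟫ = 0
    rwa [real_inner_comm]

lemma SupportsAt.mem {C : Set S2} (hC : IsBody C) {v p : S2} (h : SupportsAt C v p) : p ∈ C :=
  hC.1.frontier_subset h.1

lemma SupportsAt.inner_eq_zero {C : Set S2} {v p : S2} (h : SupportsAt C v p) :
    ⟪(p : E3), (v : E3)⟫ = 0 := by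
  rw [real_inner_comm]; exact h.2.2

lemma SupportsAt.mem_polar {C : Set S2} {v p : S2} (h : SupportsAt C v p) :
    (v : E3) ∈ polar C := fun r hr => by
  rw [real_inner_comm]; exact h.2.1 hr

lemma Supports.mem_polar {C : Set S2} {v : S2} (h : Supports C v) : (v : E3) ∈ polar C :=
  h.elim fun _ hp => SupportsAt.mem_polar hp

lemma direction_mem_polar {C : Set S2} {u : E3} (hu : u ∈ polar C) (h0 : u ≠ 0) :
    (direction u h0 : E3) ∈ polar C :=
  smul_mem_polar (inv_nonneg.2 (norm_nonneg _)) hu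

/-- A bound for the unit vectors of the dual cone extends to the dual cone by homogeneity. -/
lemma mul_norm_le_inner {C : Set S2} {k : E3} {c : ℝ}
    (h : ∀ u : S2, (u : E3) ∈ polar C → c ≤ ⟪k, (u : E3)⟫) {u : E3} (hu : u ∈ polar C) :
    c * ‖u‖ ≤ ⟪k, u⟫ := by
  by_cases h0 : u = 0
  · simp [h0]
  have := h _ (direction_mem_polar hu h0)
  rw [coe_direction, real_inner_smul_right, inv_mul_eq_div, le_div_iff₀ (norm_pos_iff.2 h0)] at this
  exact this

/-- The first order condition at a point of the dual cone at which the inner product with `k`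
is minimal. -/
lemma inner_sub_smul_nonneg {C : Set S2} {k : E3} {v : S2} (hv : (v : E3) ∈ polar C)
    (hmin : ∀ u : S2, (u : E3) ∈ polar C → ⟪k, (v : E3)⟫ ≤ ⟪k, (u : E3)⟫) {u : E3}
    (hu : u ∈ polar C) : 0 ≤ ⟪u, k - ⟪k, (v : E3)⟫ • (v : E3)⟫ := by
  have key : ∀ t : ℝ, 0 ≤ t →
      ⟪k, (v : E3)⟫ * ‖(v : E3) + t • u‖ ≤ ⟪k, (v : E3)⟫ + t * ⟪k, u⟫ := fun t ht => by
    have := mul_norm_le_inner hmin (add_mem_polar hv (smul_mem_polar ht hu))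
    rwa [inner_add_right, real_inner_smul_right] at this
  rw [inner_sub_right, real_inner_smul_right, real_inner_comm k u, real_inner_comm (v : E3) u]
  set c := ⟪k, (v : E3)⟫
  set a := ⟪(v : E3), u⟫ with ha
  -- For `c ≥ 0` Cauchy–Schwarz suffices at `t = 1`. For `c < 0` the norm must be bounded from
  -- above, and a violation at first order would survive for small `t`.
  rcases le_or_gt 0 c with hc | hc
  · have h1 := key 1 zero_le_one
    have h2 : 1 + a ≤ ‖(v : E3) + (1 : ℝ) • u‖ := by
      have := real_inner_le_norm (v : E3) ((v : E3) + (1 : ℝ) • u)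
      rwa [inner_add_right, inner_self_sphere, real_inner_smul_right, norm_coe_sphere, one_mul,
        one_mul, ← ha] at this
    nlinarith [mul_le_mul_of_nonneg_left h2 hc]
  · by_contra! hlt
    have hn : ∀ t : ℝ, ‖(v : E3) + t • u‖ ≤ 1 + t * a + t ^ 2 * ‖u‖ ^ 2 / 2 := fun t => by
      have h1 : ‖(v : E3) + t • u‖ ^ 2 = 1 + 2 * (t * a) + t ^ 2 * ‖u‖ ^ 2 := by
        rw [norm_add_sq_real, norm_coe_sphere, real_inner_smul_right, norm_smul, mul_pow]
        simp [ha]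
      nlinarith [sq_nonneg (‖(v : E3) + t • u‖ - 1)]
    set d := c * a - ⟪k, u⟫ with hd
    have hd0 : 0 < d := by linarith
    have hq : 0 < -c * ‖u‖ ^ 2 + 1 := by
      nlinarith [mul_nonneg (neg_nonneg.2 hc.le) (sq_nonneg ‖u‖)]
    -- Small enough for the linear gain to beat the quadratic error; the summand 1 keeps the
    -- denominator positive.
    set t := d / (-c * ‖u‖ ^ 2 + 1) with ht
    have ht0 : 0 < t := div_pos hd0 hq
    have htq : t * (-c * ‖u‖ ^ 2 + 1) = d := div_mul_cancel₀ _ hq.ne'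
    have h1 := key t ht0.le
    have h2 := mul_le_mul_of_nonpos_left (hn t) hc.le
    have h3 : t * d ≤ t * (t * (-c * ‖u‖ ^ 2) / 2) := by rw [hd]; nlinarith
    have h4 := le_of_mul_le_mul_left h3 ht0
    nlinarith

lemma isCompact_unit_polar (C : Set S2) : IsCompact {v : S2 | (v : E3) ∈ polar C} :=
  ((isClosed_polar C).preimage continuous_subtype_val).isCompact

lemma exists_ne_mem_polar {C : Set S2} (hC : IsBody C) (k : S2) :
    ∃ u : S2, (u : E3) ∈ polar C ∧ u ≠ k := by
  obtain ⟨u, hu, h⟩ := exists_mem_polar_ne_smul hC k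
  have h0 : u ≠ 0 := by simpa using h 0
  refine ⟨direction u h0, direction_mem_polar hu h0, fun h' => h ‖u‖ ?_⟩
  rw [← h', coe_direction, smul_inv_smul₀ (norm_ne_zero_iff.2 h0)]

lemma inner_lt_one {x y : S2} (h : x ≠ y) : ⟪(x : E3), (y : E3)⟫ < 1 :=
  lt_of_le_of_ne (inner_le_one x y) (mt (inner_eq_one_iff x y).1 h)

lemma neg_one_lt_inner {C : Set S2} (hC : IsBody C) {x y : S2} (hx : (x : E3) ∈ polar C)
    (hy : (y : E3) ∈ polar C) : -1 < ⟪(x : E3), (y : E3)⟫ := by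
  refine lt_of_le_of_ne (neg_one_le_inner x y) fun h => ?_
  have := (inner_eq_neg_one_iff x y).1 h.symm
  rw [this] at hx
  exact neg_notMem_polar hC hy (sphere_ne_zero y) (by simpa using hx)

lemma sub_smul_ne_zero {x y : S2} (h : x ≠ y) (h' : x ≠ -y) (t : ℝ) :
    (x : E3) - t • (y : E3) ≠ 0 := by
  intro h0
  have h1 : (x : E3) = t • (y : E3) := sub_eq_zero.1 h0
  have h2 := norm_coe_sphere x
  rw [h1, norm_smul, norm_coe_sphere, mul_one, Real.norm_eq_abs] at h2
  rcases abs_eq zero_le_one |>.1 h2 with rfl | rfl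
  · exact h (Subtype.ext (by simpa using h1))
  · exact h' (Subtype.ext (by simpa using h1))

/-- If `v` is a point of the dual body farthest from `k`, then the body touches the great circle
of `H(v)` at the center of the semicircle of the lune `H(k) ∩ H(v)`. -/
lemma direction_mem_of_isMin {C : Set S2} (hC : IsBody C) {k v : S2} (hv : (v : E3) ∈ polar C)
    (hmin : ∀ u : S2, (u : E3) ∈ polar C → ⟪(k : E3), (v : E3)⟫ ≤ ⟪(k : E3), (u : E3)⟫)
    (h0 : (k : E3) - ⟪(k : E3), (v : E3)⟫ • (v : E3) ≠ 0) :
    direction _ h0 ∈ C :=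
  direction_mem_of_inner_nonneg hC h0 fun _ hu => inner_sub_smul_nonneg hv hmin hu

lemma inner_sub_smul_self (k : E3) (v : S2) :
    ⟪k - ⟪k, (v : E3)⟫ • (v : E3), (v : E3)⟫ = 0 := by
  rw [inner_sub_left, real_inner_smul_left, inner_self_sphere]; ring

lemma ne_and_ne_neg_of_isMin {C : Set S2} (hC : IsBody C) {k v : S2} (hk : (k : E3) ∈ polar C)
    (hv : (v : E3) ∈ polar C)
    (hmin : ∀ u : S2, (u : E3) ∈ polar C → ⟪(k : E3), (v : E3)⟫ ≤ ⟪(k : E3), (u : E3)⟫) :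
    k ≠ v ∧ k ≠ -v := by
  constructor
  · obtain ⟨u, hu, huk⟩ := exists_ne_mem_polar hC k
    rintro rfl
    have := hmin u hu
    rw [inner_self_sphere] at this
    linarith [inner_lt_one huk.symm]
  · intro h
    have := neg_one_lt_inner hC hk hv
    rw [(inner_eq_neg_one_iff k v).2 h] at this
    exact lt_irrefl _ this

lemma supports_of_isMin {C : Set S2} (hC : IsBody C) {k v : S2} (hk : (k : E3) ∈ polar C)
    (hv : (v : E3) ∈ polar C)
    (hmin : ∀ u : S2, (u : E3) ∈ polar C → ⟪(k : E3), (v : E3)⟫ ≤ ⟪(k : E3), (u : E3)⟫) :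
    Supports C v := by
  obtain ⟨h1, h2⟩ := ne_and_ne_neg_of_isMin hC hk hv hmin
  have h0 := sub_smul_ne_zero h1 h2 ⟪(k : E3), (v : E3)⟫
  refine ⟨_, supportsAt_of_inner_eq_zero hv (direction_mem_of_isMin hC hv hmin h0) ?_⟩
  rw [coe_direction, real_inner_smul_left, inner_sub_smul_self, mul_zero]

/-- The dual body may contain centers of hemispheres that do not support `C`, but a point of it
farthest from `k` always supports, so the minimum can be taken over the whole dual body. -/
lemma exists_width_eq {C : Set S2} (hC : IsBody C) {k : S2} (hk : (k : E3) ∈ polar C) :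
    ∃ v : S2, (v : E3) ∈ polar C ∧ width C k = Real.pi - Real.arccos ⟪(k : E3), (v : E3)⟫ ∧
      ∀ u : S2, (u : E3) ∈ polar C → ⟪(k : E3), (v : E3)⟫ ≤ ⟪(k : E3), (u : E3)⟫ := by
  obtain ⟨v, hv, hmin⟩ := (isCompact_unit_polar C).exists_isMinOn ⟨k, hk⟩
    (f := fun u : S2 => ⟪(k : E3), (u : E3)⟫)
    ((continuous_const.inner continuous_subtype_val).continuousOn)
  have hmin : ∀ u : S2, (u : E3) ∈ polar C → ⟪(k : E3), (v : E3)⟫ ≤ ⟪(k : E3), (u : E3)⟫ :=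
    fun u hu => hmin hu
  refine ⟨v, hv, IsLeast.csInf_eq ⟨?_, ?_⟩, hmin⟩
  · have h := ne_and_ne_neg_of_isMin hC hk hv hmin
    exact ⟨v, supports_of_isMin hC hk hv hmin, h, (luneThickness_eq h).symm⟩
  · rintro _ ⟨k', hk', hl, rfl⟩
    rw [luneThickness_eq hl]
    exact sub_le_sub_left (Real.arccos_le_arccos (hmin k' hk'.mem_polar)) _

/-- The thickness of a body is supplementary to the diameter of the dual body. -/
lemma exists_thickness_eq {C : Set S2} (hC : IsBody C) :
    ∃ y z : S2, (y : E3) ∈ polar C ∧ (z : E3) ∈ polar C ∧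
      thickness C = Real.pi - Real.arccos ⟪(y : E3), (z : E3)⟫ ∧
      ∀ u v : S2, (u : E3) ∈ polar C → (v : E3) ∈ polar C →
        ⟪(y : E3), (z : E3)⟫ ≤ ⟪(u : E3), (v : E3)⟫ := by
  obtain ⟨r, hr⟩ := hC.2.2
  obtain ⟨k, hk, -⟩ := exists_ne_mem_polar hC r
  obtain ⟨⟨y, z⟩, ⟨hy, hz⟩, hmin⟩ :=
    ((isCompact_unit_polar C).prod (isCompact_unit_polar C)).exists_isMinOn ⟨(k, k), hk, hk⟩
    (f := fun q : S2 × S2 => ⟪(q.1 : E3), (q.2 : E3)⟫)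
    (((continuous_subtype_val.comp continuous_fst).inner
      (continuous_subtype_val.comp continuous_snd)).continuousOn)
  have hmin : ∀ u v : S2, (u : E3) ∈ polar C → (v : E3) ∈ polar C →
      ⟪(y : E3), (z : E3)⟫ ≤ ⟪(u : E3), (v : E3)⟫ := fun u v hu hv => hmin (Set.mk_mem_prod hu hv)
  refine ⟨y, z, hy, hz, IsLeast.csInf_eq ⟨?_, ?_⟩, hmin⟩
  · refine ⟨y, supports_of_isMin hC hz hy fun u hu => ?_, ?_⟩
    · rw [real_inner_comm]; exact hmin u z hu hz |>.trans_eq (real_inner_comm _ _)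
    · obtain ⟨v, hv, hw, hv'⟩ := exists_width_eq hC hy
      rw [hw, le_antisymm (hv' z hz) (hmin y v hy hv)]
  · rintro _ ⟨k', hk', rfl⟩
    obtain ⟨v, hv, hw, -⟩ := exists_width_eq hC hk'.mem_polar
    rw [hw]
    exact sub_le_sub_left (Real.arccos_le_arccos (hmin _ _ hk'.mem_polar hv)) _

/-! ### Cutting pieces off a reduced body -/

/-- The part of `C` on the non-negative side of the plane orthogonal to `x`. -/
def cut (C : Set S2) (x : E3) : Set S2 := C ∩ {r | 0 ≤ ⟪x, (r : E3)⟫}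

lemma cut_subset (C : Set S2) (x : E3) : cut C x ⊆ C := Set.inter_subset_left

lemma isBody_cut {C : Set S2} (hC : IsBody C) {x : E3} {r : S2} (hr : r ∈ interior C)
    (hx : 0 < ⟪x, (r : E3)⟫) : IsBody (cut C x) := by
  have hcont : Continuous fun r : S2 => ⟪x, (r : E3)⟫ :=
    continuous_const.inner continuous_subtype_val
  refine ⟨hC.1.inter (isClosed_le continuous_const hcont), ⟨fun a ha ha' => ?_, ?_⟩, r, ?_⟩
  · exact hC.2.1.1 a ha.1 ha'.1
  · rintro a ⟨ha, hxa⟩ b ⟨hb, hxb⟩ y hy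
    refine ⟨hC.2.1.2 a ha b hb hy, ?_⟩
    obtain ⟨s, t, hs, ht, hy⟩ := hy
    change 0 ≤ ⟪x, (y : E3)⟫
    rw [hy, inner_add_right, real_inner_smul_right, real_inner_smul_right]
    exact add_nonneg (mul_nonneg hs hxa) (mul_nonneg ht hxb)
  · rw [cut, interior_inter]
    have hsub : {y : S2 | 0 < ⟪x, (y : E3)⟫} ⊆ {y : S2 | 0 ≤ ⟪x, (y : E3)⟫} :=
      fun y (hy : 0 < ⟪x, (y : E3)⟫) => hy.le
    exact ⟨hr, interior_maximal hsub (isOpen_lt continuous_const hcont) hx⟩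

lemma cut_ne {C : Set S2} {x : E3} (hx : x ∉ polar C) : cut C x ≠ C := fun h => hx fun r hr => by
  rw [← h] at hr
  rw [real_inner_comm]; exact hr.2

/-- Cutting a small piece off a reduced body produces a lune thinner than the body, one of whose
semicircles has its center on the cut. -/
lemma exists_thin_lune_of_cut {R : Set S2} (hR : IsReduced R) {κ : ℝ}
    (hκ : thickness R = Real.pi - Real.arccos κ)
    (hmin : ∀ u v : S2, (u : E3) ∈ polar R → (v : E3) ∈ polar R → κ ≤ ⟪(u : E3), (v : E3)⟫)
    {x : E3} (hx : x ∉ polar R) {r : S2} (hr : r ∈ interior R) (hxr : 0 < ⟪x, (r : E3)⟫) :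
    ∃ y z c : S2, (y : E3) ∈ polar (cut R x) ∧ (y : E3) ∉ polar R ∧ (z : E3) ∈ polar (cut R x) ∧
      ⟪(y : E3), (z : E3)⟫ ≤ κ ∧ c ∈ R ∧ ⟪x, (c : E3)⟫ = 0 ∧ ⟪(c : E3), (y : E3)⟫ = 0 ∧
      (z : E3) - ⟪(z : E3), (y : E3)⟫ • (y : E3) =
        ‖(z : E3) - ⟪(z : E3), (y : E3)⟫ • (y : E3)‖ • (c : E3) := by
  have hB := isBody_cut hR.1 hr hxr
  obtain ⟨y, z, hy, hz, hth, hyz⟩ := exists_thickness_eq hB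
  have hlt : ⟪(y : E3), (z : E3)⟫ < κ := by
    have h := hR.2 _ hB (cut_subset R x) (cut_ne hx)
    rw [hth, hκ] at h
    by_contra! h'
    linarith [Real.arccos_le_arccos h']
  suffices main : ∀ y z : S2, (y : E3) ∈ polar (cut R x) → (z : E3) ∈ polar (cut R x) →
      ⟪(y : E3), (z : E3)⟫ < κ →
      (∀ u v : S2, (u : E3) ∈ polar (cut R x) → (v : E3) ∈ polar (cut R x) →
        ⟪(y : E3), (z : E3)⟫ ≤ ⟪(u : E3), (v : E3)⟫) → (y : E3) ∉ polar R →
      ∃ y z c : S2, (y : E3) ∈ polar (cut R x) ∧ (y : E3) ∉ polar R ∧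
      (z : E3) ∈ polar (cut R x) ∧
      ⟪(y : E3), (z : E3)⟫ ≤ κ ∧ c ∈ R ∧ ⟪x, (c : E3)⟫ = 0 ∧ ⟪(c : E3), (y : E3)⟫ = 0 ∧
      (z : E3) - ⟪(z : E3), (y : E3)⟫ • (y : E3) =
        ‖(z : E3) - ⟪(z : E3), (y : E3)⟫ • (y : E3)‖ • (c : E3) by
    -- Two vectors of `polar R` have inner product at least `κ`, so one of `y`, `z` is new; by
    -- symmetry it may be called `y`.
    by_cases hyR : (y : E3) ∈ polar R
    · have hzR : (z : E3) ∉ polar R := fun hzR => (hmin y z hyR hzR).not_gt hlt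
      refine main z y hz hy (by rwa [real_inner_comm]) (fun u v hu hv => ?_) hzR
      rw [real_inner_comm]; exact hyz u v hu hv
    · exact main y z hy hz hlt hyz hyR
  clear! y z
  intro y z hy hz hlt hyz hyR
  have hm : ∀ u : S2, (u : E3) ∈ polar (cut R x) →
      ⟪(z : E3), (y : E3)⟫ ≤ ⟪(z : E3), (u : E3)⟫ := fun u hu => by
    rw [real_inner_comm]; exact hyz z u hz hu
  obtain ⟨h1, h2⟩ := ne_and_ne_neg_of_isMin hB hz hy hm
  have h0 := sub_smul_ne_zero h1 h2 ⟪(z : E3), (y : E3)⟫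
  have hc := direction_mem_of_isMin hB hy hm h0
  have hcy : ⟪(direction _ h0 : E3), (y : E3)⟫ = 0 := by
    rw [coe_direction, real_inner_smul_left, inner_sub_smul_self, mul_zero]
  refine ⟨y, z, direction _ h0, hy, hyR, hz, hlt.le, hc.1, ?_, hcy, ?_⟩
  · set c := direction _ h0
    by_contra hne
    have hpos : 0 < ⟪x, (c : E3)⟫ := lt_of_le_of_ne hc.2 (Ne.symm hne)
    -- If `c` were off the cut, a short step from `c` towards `q` would stay in the cut body but
    -- leave the hemisphere of `y`.
    obtain ⟨q, hq, hqy⟩ : ∃ q ∈ R, ⟪(q : E3), (y : E3)⟫ < 0 := by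
      simpa [polar] using hyR
    set ε := ⟪x, (c : E3)⟫ / (1 + |⟪x, (q : E3)⟫|) with hε
    have hε0 : 0 < ε := by positivity
    have hεq : ε * (1 + |⟪x, (q : E3)⟫|) = ⟪x, (c : E3)⟫ := div_mul_cancel₀ _ (by positivity)
    have hneg : ⟪(1 : ℝ) • (c : E3) + ε • (q : E3), (y : E3)⟫ < 0 := by
      rw [inner_add_left, real_inner_smul_left, real_inner_smul_left, hcy]
      nlinarith
    have hv0 : (1 : ℝ) • (c : E3) + ε • (q : E3) ≠ 0 := by
      intro h; rw [h, inner_zero_left] at hneg; exact lt_irrefl _ hneg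
    have hmem : direction _ hv0 ∈ cut R x := by
      refine ⟨normalized_add_mem hR.1.2.1 hc.1 hq zero_le_one hε0.le hv0, ?_⟩
      change 0 ≤ ⟪x, _⟫
      rw [coe_direction, real_inner_smul_right, inner_add_right, real_inner_smul_right,
        real_inner_smul_right]
      refine mul_nonneg (by positivity) ?_
      nlinarith [neg_abs_le ⟪x, (q : E3)⟫]
    have := hy _ hmem
    rw [coe_direction, real_inner_smul_left] at this
    exact hneg.not_ge (nonneg_of_mul_nonneg_right this (inv_pos.2 (norm_pos_iff.2 hv0)))
  · rw [coe_direction, smul_inv_smul₀ (norm_ne_zero_iff.2 h0)]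

/-- A point `r` of `R` may be cut off for every `i`, but `r + t q` with `q` interior lies strictly
inside the hemisphere of `k` and is eventually kept. A small `t` then gives the inequality at `r`.
-/
lemma mem_polar_of_tendsto {R : Set S2} (hR : IsBody R) {k : S2} (hk : (k : E3) ∈ polar R)
    {x : ℕ → E3} (hx : Tendsto x atTop (𝓝 (k : E3))) {y : ℕ → E3} {a : E3}
    (hy : ∀ i, y i ∈ polar (cut R (x i))) (ha : Tendsto y atTop (𝓝 a)) : a ∈ polar R := by
  intro r hr
  obtain ⟨q, hq, -, hpos⟩ := exists_interior_inner_pos hR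
  have hqk := hpos k hk (sphere_ne_zero k)
  have key : ∀ t : ℝ, 0 < t → 0 ≤ ⟪(r : E3), a⟫ + t * ⟪(q : E3), a⟫ := fun t ht => by
    set v := (1 : ℝ) • (r : E3) + t • (q : E3) with hv
    have hkv : 0 < ⟪(k : E3), v⟫ := by
      rw [real_inner_comm, hv, inner_add_left, real_inner_smul_left, real_inner_smul_left, one_mul]
      exact add_pos_of_nonneg_of_pos (hk r hr) (mul_pos ht hqk)
    have hv0 : v ≠ 0 := by
      intro h; rw [h, inner_zero_right] at hkv; exact lt_irrefl _ hkv
    have hev : ∀ᶠ i in atTop, 0 ≤ ⟪v, y i⟫ := by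
      have h1 : Tendsto (fun i => ⟪x i, v⟫) atTop (𝓝 ⟪(k : E3), v⟫) :=
        hx.inner tendsto_const_nhds
      filter_upwards [h1.eventually (lt_mem_nhds hkv)] with i hi
      have hmem : direction v hv0 ∈ cut R (x i) := by
        refine ⟨normalized_add_mem hR.2.1 hr hq zero_le_one ht.le hv0, ?_⟩
        change 0 ≤ ⟪x i, _⟫
        rw [coe_direction, real_inner_smul_right]
        positivity
      have := hy i _ hmem
      rw [coe_direction, real_inner_smul_left] at this
      exact nonneg_of_mul_nonneg_right this (inv_pos.2 (norm_pos_iff.2 hv0))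
    have := ge_of_tendsto (tendsto_const_nhds.inner ha) hev
    rwa [hv, inner_add_left, real_inner_smul_left, real_inner_smul_left, one_mul] at this
  by_contra! hlt
  have h1 := key (-⟪(r : E3), a⟫ / (2 * (1 + |⟪(q : E3), a⟫|))) (by
    apply div_pos <;> [linarith; positivity])
  set t := -⟪(r : E3), a⟫ / (2 * (1 + |⟪(q : E3), a⟫|)) with ht
  have h2 : t * (2 * (1 + |⟪(q : E3), a⟫|)) = -⟪(r : E3), a⟫ := div_mul_cancel₀ _ (by positivity)
  have h3 : 0 < t := div_pos (by linarith) (by positivity)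
  nlinarith [le_abs_self ⟪(q : E3), a⟫, mul_le_mul_of_nonneg_left (le_abs_self ⟪(q : E3), a⟫) h3.le]

/-- The lunes obtained by cutting smaller and smaller pieces off a reduced body accumulate at a lune
that contains the body and has the same thickness. -/
lemma exists_limit_lune {R : Set S2} (hR : IsReduced R) {κ : ℝ}
    (hκ : thickness R = Real.pi - Real.arccos κ)
    (hmin : ∀ u v : S2, (u : E3) ∈ polar R → (v : E3) ∈ polar R → κ ≤ ⟪(u : E3), (v : E3)⟫)
    {k : S2} (hk : (k : E3) ∈ polar R) {x : ℕ → E3} (hx : Tendsto x atTop (𝓝 (k : E3)))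
    (hxR : ∀ i, x i ∉ polar R) :
    ∃ (φ : ℕ → ℕ) (y c : ℕ → S2) (a c₀ : S2), Tendsto φ atTop atTop ∧ Tendsto y atTop (𝓝 a) ∧
      Tendsto c atTop (𝓝 c₀) ∧
      (∀ i, (y i : E3) ∈ polar (cut R (x (φ i))) ∧ (y i : E3) ∉ polar R ∧ c i ∈ R ∧
        ⟪x (φ i), (c i : E3)⟫ = 0 ∧ ⟪(c i : E3), (y i : E3)⟫ = 0) ∧
      (a : E3) ∈ polar R ∧ c₀ ∈ R ∧ ⟪(c₀ : E3), (a : E3)⟫ = 0 ∧ ⟪(c₀ : E3), (k : E3)⟫ = 0 ∧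
      κ • (a : E3) + √(1 - κ ^ 2) • (c₀ : E3) ∈ polar R := by
  obtain ⟨r, hr, hri, hpos⟩ := exists_interior_inner_pos hR.1
  have hev : ∀ᶠ i in atTop, 0 < ⟪x i, (r : E3)⟫ := by
    have h1 : Tendsto (fun i => ⟪x i, (r : E3)⟫) atTop (𝓝 ⟪(k : E3), (r : E3)⟫) :=
      hx.inner tendsto_const_nhds
    refine h1.eventually (lt_mem_nhds ?_)
    rw [real_inner_comm]; exact hpos k hk (sphere_ne_zero k)
  -- From `N` on the cut keeps the interior point `r`, so the cut sets are bodies.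
  obtain ⟨N, hN⟩ := eventually_atTop.1 hev
  choose y z c hy hyR hz hyz hc hxc hcy hw using fun i => exists_thin_lune_of_cut hR hκ hmin
    (hxR (i + N)) hri (hN (i + N) (Nat.le_add_left _ _))
  obtain ⟨⟨a, b, c₀⟩, -, φ, hφ, hlim⟩ := (isCompact_univ (X := S2 × S2 × S2)).tendsto_subseq
    (x := fun i => (y i, z i, c i)) (fun _ => Set.mem_univ _)
  have hya : Tendsto (fun i => y (φ i)) atTop (𝓝 a) :=
    (continuous_fst.tendsto _).comp hlim
  have hzb : Tendsto (fun i => z (φ i)) atTop (𝓝 b) :=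
    (continuous_fst.tendsto _).comp ((continuous_snd.tendsto _).comp hlim)
  have hcc : Tendsto (fun i => c (φ i)) atTop (𝓝 c₀) :=
    (continuous_snd.tendsto _).comp ((continuous_snd.tendsto _).comp hlim)
  have hya' := (continuous_subtype_val.tendsto a).comp hya
  have hzb' := (continuous_subtype_val.tendsto b).comp hzb
  have hcc' := (continuous_subtype_val.tendsto c₀).comp hcc
  have hφN : Tendsto (fun i => φ i + N) atTop atTop :=
    (tendsto_add_atTop_nat N).comp hφ.tendsto_atTop
  have hxk := hx.comp hφN
  have ha : (a : E3) ∈ polar R := mem_polar_of_tendsto hR.1 hk hxk (fun i => hy (φ i)) hya'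
  have hb : (b : E3) ∈ polar R := mem_polar_of_tendsto hR.1 hk hxk (fun i => hz (φ i)) hzb'
  have hab : ⟪(b : E3), (a : E3)⟫ = κ := by
    rw [real_inner_comm]
    exact le_antisymm (le_of_tendsto' (Tendsto.inner (𝕜 := ℝ) hya' hzb') fun i => hyz (φ i)) (hmin a b ha hb)
  have hca : ⟪(c₀ : E3), (a : E3)⟫ = 0 :=
    tendsto_nhds_unique (Tendsto.inner (𝕜 := ℝ) hcc' hya') (tendsto_const_nhds.congr fun i => (hcy (φ i)).symm)
  refine ⟨fun i => φ i + N, fun i => y (φ i), fun i => c (φ i), a, c₀, hφN, hya, hcc,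
    fun i => ⟨hy _, hyR _, hc _, hxc _, hcy _⟩, ha,
    hR.1.1.mem_of_tendsto hcc (Eventually.of_forall fun i => hc _), hca, ?_, ?_⟩
  · rw [real_inner_comm]
    exact tendsto_nhds_unique (Tendsto.inner (𝕜 := ℝ) hxk hcc')
      (tendsto_const_nhds.congr fun i => (hxc (φ i)).symm)
  · have h1 := hzb'.sub ((Tendsto.inner (𝕜 := ℝ) hzb' hya').smul hya')
    have h2 := h1.norm.smul hcc'
    have h3 := tendsto_nhds_unique h1 (h2.congr fun i => (hw (φ i)).symm)
    rw [hab] at h3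
    have h4 : ‖(b : E3) - κ • (a : E3)‖ = √(1 - κ ^ 2) := by
      rw [← Real.sqrt_sq (norm_nonneg _), norm_sub_sq_real, norm_coe_sphere, norm_smul, mul_pow,
        norm_coe_sphere, real_inner_smul_right, hab]
      congr 1
      simp; ring
    rw [h4, sub_eq_iff_eq_add'] at h3
    rwa [← h3]

/-- Every supporting great circle of a reduced body is also met at a center of a semicircle
of a lune of minimal thickness. -/
lemma exists_minimal_lune {R : Set S2} (hR : IsReduced R) {κ : ℝ}
    (hκ : thickness R = Real.pi - Real.arccos κ)
    (hmin : ∀ u v : S2, (u : E3) ∈ polar R → (v : E3) ∈ polar R → κ ≤ ⟪(u : E3), (v : E3)⟫)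
    {k p : S2} (hk : (k : E3) ∈ polar R) (hp : p ∈ R) (hpk : ⟪(p : E3), (k : E3)⟫ = 0) :
    ∃ a c : S2, (a : E3) ∈ polar R ∧ c ∈ R ∧ ⟪(c : E3), (a : E3)⟫ = 0 ∧
      ⟪(c : E3), (k : E3)⟫ = 0 ∧ κ • (a : E3) + √(1 - κ ^ 2) • (c : E3) ∈ polar R := by
  have hx : Tendsto (fun i : ℕ => (k : E3) - (1 / ((i : ℝ) + 1)) • (p : E3)) atTop
      (𝓝 (k : E3)) := by
    have := tendsto_const_nhds (x := (k : E3)).sub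
      ((tendsto_one_div_add_atTop_nhds_zero_nat (𝕜 := ℝ)).smul_const (p : E3))
    simpa using this
  obtain ⟨-, -, -, a, c, -, -, -, -, h⟩ := exists_limit_lune hR hκ hmin hk hx fun i h => by
    have := h p hp
    rw [inner_sub_right, hpk, real_inner_smul_right, inner_self_sphere] at this
    have : (0 : ℝ) < 1 / ((i : ℝ) + 1) := by positivity
    linarith
  exact ⟨a, c, h⟩

/-! ### Orthonormal frames and extreme supporting hemispheres -/

lemma inner_eq_sum (a b : E3) : ⟪a, b⟫ = a 0 * b 0 + a 1 * b 1 + a 2 * b 2 := by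
  simp [PiLp.inner_apply, Fin.sum_univ_three]; ring

lemma inner_cross_cross (a b c d : E3) :
    ⟪cross a b, cross c d⟫ = ⟪a, c⟫ * ⟪b, d⟫ - ⟪a, d⟫ * ⟪b, c⟫ := by
  simp only [inner_eq_sum, cross, cross_apply]
  simp
  ring

lemma inner_left_cross (a b : E3) : ⟪a, cross a b⟫ = 0 := by
  simp only [inner_eq_sum, cross, cross_apply]
  simp
  ring

lemma inner_right_cross (a b : E3) : ⟪b, cross a b⟫ = 0 := by
  simp only [inner_eq_sum, cross, cross_apply]
  simp
  ring

/-- Three pairwise orthogonal unit vectors. -/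
structure IsFrame (e f g : E3) : Prop where
  ee : ⟪e, e⟫ = 1
  ff : ⟪f, f⟫ = 1
  gg : ⟪g, g⟫ = 1
  ef : ⟪e, f⟫ = 0
  eg : ⟪e, g⟫ = 0
  fg : ⟪f, g⟫ = 0

lemma IsFrame.inner_eq {e f g : E3} (h : IsFrame e f g) (u v : E3) :
    ⟪u, v⟫ = ⟪e, u⟫ * ⟪e, v⟫ + ⟪f, u⟫ * ⟪f, v⟫ + ⟪g, u⟫ * ⟪g, v⟫ := by
  have hon : Orthonormal ℝ ![e, f, g] := by
    rw [orthonormal_iff_ite]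
    intro i j
    have hfe : ⟪f, e⟫ = 0 := by rw [real_inner_comm]; exact h.ef
    have hge : ⟪g, e⟫ = 0 := by rw [real_inner_comm]; exact h.eg
    have hgf : ⟪g, f⟫ = 0 := by rw [real_inner_comm]; exact h.fg
    have hn : ∀ w : E3, ⟪w, w⟫ = 1 → ‖w‖ = 1 := fun w hw =>
      (pow_eq_one_iff_of_nonneg (norm_nonneg w) two_ne_zero).1
        (by rw [← real_inner_self_eq_norm_sq, hw])
    fin_cases i <;> fin_cases j <;>
      simp [hn e h.ee, hn f h.ff, hn g h.gg, h.ef, h.eg, h.fg, hfe, hge, hgf]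
  have hcard : Fintype.card (Fin 3) = Module.finrank ℝ E3 := by simp
  let b := basisOfOrthonormalOfCardEqFinrank hon hcard
  have hb : Orthonormal ℝ b := by
    rw [coe_basisOfOrthonormalOfCardEqFinrank]; exact hon
  have := (b.toOrthonormalBasis hb).sum_inner_mul_inner u v
  rw [← this, Fin.sum_univ_three]
  simp [b, real_inner_comm]

lemma IsFrame.eq_sum {e f g : E3} (h : IsFrame e f g) (u : E3) :
    u = ⟪e, u⟫ • e + ⟪f, u⟫ • f + ⟪g, u⟫ • g := by
  refine ext_inner_left ℝ fun v => ?_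
  rw [h.inner_eq v u]
  simp only [inner_add_right, real_inner_smul_right, real_inner_comm v]
  ring

lemma isFrame_cross {p r : S2} (h : ⟪(p : E3), (r : E3)⟫ = 0) :
    IsFrame (r : E3) (cross p r) (p : E3) where
  ee := inner_self_sphere r
  gg := inner_self_sphere p
  ff := by
    rw [inner_cross_cross, inner_self_sphere, inner_self_sphere, h, zero_mul, sub_zero, one_mul]
  ef := inner_right_cross _ _
  eg := by rw [real_inner_comm]; exact h
  fg := by rw [real_inner_comm]; exact inner_left_cross _ _

/-- Two different, non-opposite great circles meet in a pair of antipodes only, and a convex set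
contains at most one of them. This identifies the common point in `Before` with the point of
support. -/
lemma eq_of_orthogonal {C : Set S2} (hC : IsBody C) {c p r l : S2} (hc : c ∈ C) (hp : p ∈ C)
    (hcr : ⟪(c : E3), (r : E3)⟫ = 0) (hcl : ⟪(c : E3), (l : E3)⟫ = 0)
    (hpr : ⟪(p : E3), (r : E3)⟫ = 0) (hpl : ⟪(p : E3), (l : E3)⟫ = 0)
    (h1 : l ≠ r) (h2 : l ≠ -r) : c = p := by
  have hF := isFrame_cross hpr
  have h3 := hF.inner_eq (l : E3) (c : E3)
  have h4 := hF.inner_eq (l : E3) (l : E3)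
  have h5 := hF.inner_eq (c : E3) (c : E3)
  rw [real_inner_comm, hcl, hpl, real_inner_comm (c : E3) (r : E3), hcr] at h3
  rw [hpl, inner_self_sphere] at h4
  rw [inner_self_sphere, real_inner_comm (c : E3) (r : E3), hcr] at h5
  have hl : ⟪cross p r, (l : E3)⟫ ≠ 0 := by
    intro h0
    rw [h0] at h4
    have h6 : (⟪(r : E3), (l : E3)⟫ - 1) * (⟪(r : E3), (l : E3)⟫ + 1) = 0 := by linarith
    rw [real_inner_comm] at h6
    rcases mul_eq_zero.1 h6 with h6 | h6
    · exact h1 ((inner_eq_one_iff l r).1 (by linarith))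
    · exact h2 ((inner_eq_neg_one_iff l r).1 (by linarith))
  have h7 : ⟪cross p r, (c : E3)⟫ = 0 := by
    have : ⟪cross p r, (l : E3)⟫ * ⟪cross p r, (c : E3)⟫ = 0 := by linarith
    exact (mul_eq_zero.1 this).resolve_left hl
  rw [h7] at h5
  have h6 : (⟪(p : E3), (c : E3)⟫ - 1) * (⟪(p : E3), (c : E3)⟫ + 1) = 0 := by linarith
  rw [real_inner_comm] at h6
  rcases mul_eq_zero.1 h6 with h6 | h6
  · exact (inner_eq_one_iff c p).1 (by linarith)
  · have := (inner_eq_neg_one_iff c p).1 (by linarith)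
    exact absurd (this ▸ hc) (hC.2.1.1 p hp)

lemma ne_neg_of_mem_polar {C : Set S2} (hC : IsBody C) {x y : S2} (hx : (x : E3) ∈ polar C)
    (hy : (y : E3) ∈ polar C) : x ≠ -y := fun h =>
  (neg_one_lt_inner hC hx hy).ne' ((inner_eq_neg_one_iff x y).2 h)

/-- A hemisphere between two different ones supporting at `p` arises from the first one by a
rotation about `p`. -/
lemma circleOrder_of_before {C : Set S2} (hC : IsBody C) {p r h l : S2} (hr : SupportsAt C r p)
    (hh : SupportsAt C h p) (hl : SupportsAt C l p) (hB : Before C r h l) :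
    CircleOrder p r h l := by
  rcases hB with ⟨-, ⟨-, -, hlr⟩, ⟨h0, -⟩ | ⟨c, hc, ⟨⟨hcr, -⟩, hcl⟩, hord⟩⟩
  · exact absurd h0 (Set.Nonempty.ne_empty ⟨p, ⟨hr.2.2, hh.2.2⟩, hl.2.2⟩)
  · have : c = p := eq_of_orthogonal hC hc (hr.mem hC) (by rw [real_inner_comm]; exact hcr)
      (by rw [real_inner_comm]; exact hcl) hr.inner_eq_zero hl.inner_eq_zero hlr
      (ne_neg_of_mem_polar hC hl.mem_polar hr.mem_polar)
    rwa [this] at hord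

/-- `CircleOrder` only bounds the turn from `r` to `l` by 2π. The turn is less than π because the
bisecting direction `r + l` also supports at `p` and must be met between `r` and `l`. -/
lemma IsExtremePairAt.exists_angle {C : Set S2} (hC : IsBody C) {p r l : S2}
    (h : IsExtremePairAt C p r l) (hne : r ≠ l) :
    ∃ β : ℝ, 0 < β ∧ β < Real.pi ∧ (l : E3) = Real.cos β • (r : E3) + Real.sin β • cross p r ∧
      ∀ g, SupportsAt C g p → ∃ α : ℝ, 0 ≤ α ∧ α ≤ β ∧
        (g : E3) = Real.cos α • (r : E3) + Real.sin α • cross p r := by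
  obtain ⟨hr, hl, hall⟩ := h
  have hF := isFrame_cross hr.inner_eq_zero
  have hneg := ne_neg_of_mem_polar hC hl.mem_polar hr.mem_polar
  have hlt := inner_lt_one hne
  have hgt := neg_one_lt_inner hC hr.mem_polar hl.mem_polar
  have e1 : ∀ α : ℝ, ⟪(r : E3), Real.cos α • (r : E3) + Real.sin α • cross p r⟫ = Real.cos α :=
    fun α => by
      rw [inner_add_right, real_inner_smul_right, real_inner_smul_right, hF.ee, hF.ef]; ring
  have e2 : ∀ α : ℝ, ⟪cross p r, Real.cos α • (r : E3) + Real.sin α • cross p r⟫ = Real.sin α :=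
    fun α => by
      rw [inner_add_right, real_inner_smul_right, real_inner_smul_right, hF.ff,
        real_inner_comm, hF.ef]; ring
  have hs0 : (r : E3) + (l : E3) ≠ 0 := fun h0 => hneg (Subtype.ext (by
    simpa using eq_neg_of_add_eq_zero_right h0))
  set N := ‖(r : E3) + (l : E3)‖ with hN
  have hN0 : 0 < N := norm_pos_iff.2 hs0
  set d := direction _ hs0 with hd
  have hd' : N • (d : E3) = (r : E3) + (l : E3) := by
    rw [hd, coe_direction, smul_inv_smul₀ hN0.ne']
  have hNr : N * ⟪(r : E3), (d : E3)⟫ = 1 + ⟪(r : E3), (l : E3)⟫ := by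
    rw [← real_inner_smul_right, hd', inner_add_right, inner_self_sphere]
  have hNl : N * ⟪(l : E3), (d : E3)⟫ = ⟪(r : E3), (l : E3)⟫ + 1 := by
    rw [← real_inner_smul_right, hd', inner_add_right, inner_self_sphere, real_inner_comm]
  have hN2 : N ^ 2 = 2 + 2 * ⟪(r : E3), (l : E3)⟫ := by
    rw [hN, norm_add_sq_real, norm_coe_sphere, norm_coe_sphere]; ring
  have hdS : SupportsAt C d p := by
    refine supportsAt_of_inner_eq_zero
      (direction_mem_polar (add_mem_polar hr.mem_polar hl.mem_polar) hs0) (hr.mem hC) ?_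
    rw [hd, coe_direction, real_inner_smul_right, inner_add_right, hr.inner_eq_zero,
      hl.inner_eq_zero, add_zero, mul_zero]
  have hdr : d ≠ r := by
    intro h0
    rw [h0, inner_self_sphere, mul_one] at hNr
    nlinarith
  have hdl : d ≠ l := by
    intro h0
    rw [h0, inner_self_sphere, mul_one] at hNl
    nlinarith
  have hB := ((hall d hdS).resolve_left hdr).resolve_left hdl
  obtain ⟨-, α, β, hα0, hαβ, hβ, hα, hβl⟩ := circleOrder_of_before hC hr hdS hl hB
  have c1 : N * Real.cos α = 1 + Real.cos β := by
    rw [← e1 α, ← hα, hNr, hβl, e1]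
  have c2 : N * Real.sin α = Real.sin β := by
    rw [← e2 α, ← hα, ← real_inner_smul_right, hd', inner_add_right, hβl, e2, real_inner_comm,
      hF.ef, zero_add]
  -- For `β > π` the relations `c1`, `c2` make `sin α` negative and `N sin (β - α)` equal to `sin β
  -- < 0`, although `0 < β - α < π`.
  have hβπ : β < Real.pi := by
    by_contra! hge
    rcases hge.eq_or_lt with hge | hge
    · refine hneg (Subtype.ext ?_)
      rw [hβl, ← hge]; simp
    · have s1 : Real.sin β < 0 := by
        have := Real.sin_pos_of_pos_of_lt_pi (sub_pos.2 hge) (by linarith)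
        rw [Real.sin_sub_pi] at this
        linarith
      have s2 : Real.sin α < 0 := by
        by_contra! h'
        have := mul_nonneg hN0.le h'
        linarith
      have s3 : Real.pi < α := by
        by_contra! h'
        exact s2.not_ge (Real.sin_nonneg_of_nonneg_of_le_pi hα0.le h')
      have s4 := Real.sin_pos_of_pos_of_lt_pi (sub_pos.2 hαβ) (by linarith)
      have s5 := mul_pos hN0 s4
      rw [Real.sin_sub] at s5
      have : N * (Real.sin β * Real.cos α - Real.cos β * Real.sin α) = Real.sin β := by
        linear_combination Real.sin β * c1 - Real.cos β * c2
      linarith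
  have hβ0 : 0 < β := hα0.trans hαβ
  refine ⟨β, hβ0, hβπ, hβl, fun g hg => ?_⟩
  rcases hall g hg with rfl | rfl | hB
  · exact ⟨0, le_rfl, hβ0.le, by simp⟩
  · exact ⟨β, hβ0.le, le_rfl, hβl⟩
  -- Each `Before` brings its own angle for `l`; both describe the same vector, so they agree once
  -- both lie in [0, π].
  · obtain ⟨-, α', β', hα0', hαβ', hβ', hα', hβl'⟩ := circleOrder_of_before hC hr hg hl hB
    have hcos : Real.cos β' = Real.cos β := by rw [← e1 β', ← hβl', hβl, e1]
    have hsin : Real.sin β' = Real.sin β := by rw [← e2 β', ← hβl', hβl, e2]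
    have hsp := Real.sin_pos_of_pos_of_lt_pi hβ0 hβπ
    have hβπ' : β' ≤ Real.pi := by
      by_contra! hge
      have := Real.sin_pos_of_pos_of_lt_pi (sub_pos.2 hge) (by linarith)
      rw [Real.sin_sub_pi] at this
      linarith
    have := Real.injOn_cos ⟨(hα0'.trans hαβ').le, hβπ'⟩ ⟨hβ0.le, hβπ.le⟩ hcos
    exact ⟨α', hα0'.le, this ▸ hαβ'.le, hα'⟩

lemma IsExtremePairAt.eq_of_eq {C : Set S2} {p r : S2} (h : IsExtremePairAt C p r r) {g : S2}
    (hg : SupportsAt C g p) : g = r := by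
  rcases h.2.2 g hg with h | h | h
  · exact h
  · exact h
  · exact absurd rfl h.2.1.2.2

/-- The centers of the hemispheres supporting at a point lie to one side of an extreme one. -/
lemma IsExtremeSupporting.exists_frame {C : Set S2} (hC : IsBody C) {m : S2}
    (hm : IsExtremeSupporting C m) : ∃ (p : S2) (τ : E3), SupportsAt C m p ∧
      IsFrame (m : E3) τ (p : E3) ∧ ∀ g, SupportsAt C g p → 0 ≤ ⟪τ, (g : E3)⟫ := by
  rcases hm with ⟨p, ⟨l, h⟩ | ⟨r, h⟩⟩
  · have hF := isFrame_cross h.1.inner_eq_zero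
    refine ⟨p, cross p m, h.1, hF, fun g hg => ?_⟩
    by_cases hne : m = l
    · subst hne
      rw [h.eq_of_eq hg, real_inner_comm, hF.ef]
    · obtain ⟨β, hβ0, hβ, -, hall⟩ := h.exists_angle hC hne
      obtain ⟨α, hα0, hα, hg⟩ := hall g hg
      rw [hg, inner_add_right, real_inner_smul_right, real_inner_smul_right, hF.ff,
        real_inner_comm, hF.ef, mul_zero, zero_add, mul_one]
      exact Real.sin_nonneg_of_nonneg_of_le_pi hα0 (hα.trans hβ.le)
  · by_cases hne : r = m
    · subst hne
      have hF := isFrame_cross h.1.inner_eq_zero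
      refine ⟨p, cross p r, h.1, hF, fun g hg => ?_⟩
      rw [h.eq_of_eq hg, real_inner_comm, hF.ef]
    · obtain ⟨β, hβ0, hβ, hl, hall⟩ := h.exists_angle hC hne
      have hF := isFrame_cross h.1.inner_eq_zero
      have hef' : ⟪cross p r, (r : E3)⟫ = 0 := by rw [real_inner_comm]; exact hF.ef
      have e : ∀ α, ⟪Real.sin β • (r : E3) - Real.cos β • cross p r,
          Real.cos α • (r : E3) + Real.sin α • cross p r⟫ = Real.sin (β - α) := fun α => by
        simp only [inner_sub_left, inner_add_right, real_inner_smul_left, real_inner_smul_right,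
          hF.ee, hF.ff, hF.ef, hef', Real.sin_sub]
        ring
      -- This is the unit tangent at `l` pointing back towards `r`; its inner product with the
      -- vector at angle `α` is `sin (β - α)`.
      refine ⟨p, Real.sin β • (r : E3) - Real.cos β • cross p r, h.2.1,
        ⟨inner_self_sphere m, ?_, inner_self_sphere p, ?_, ?_, ?_⟩, fun g hg => ?_⟩
      · simp only [inner_sub_left, inner_sub_right, real_inner_smul_left, real_inner_smul_right,
          hF.ee, hF.ff, hF.ef, hef']
        linear_combination Real.sin_sq_add_cos_sq β
      · rw [hl, real_inner_comm, e, sub_self, Real.sin_zero]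
      · rw [real_inner_comm]; exact h.2.1.inner_eq_zero
      · simp only [inner_sub_left, real_inner_smul_left, hF.eg, hF.fg]; ring
      · obtain ⟨α, hα0, hα, hg⟩ := hall g hg
        rw [hg, e]
        exact Real.sin_nonneg_of_nonneg_of_le_pi (by linarith) (by linarith)

/-- The center of an extreme supporting hemisphere is an extreme point of the dual body. -/
lemma IsExtremeSupporting.eq_smul_of_add_eq {C : Set S2} (hC : IsBody C) {m : S2}
    (hm : IsExtremeSupporting C m) {u v : E3} (hu : u ∈ polar C) (hv : v ∈ polar C)
    (huv : u + v = m) : u = ⟪(m : E3), u⟫ • (m : E3) := by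
  obtain ⟨p, τ, hp, hF, hτ⟩ := hm.exists_frame hC
  have hpC := hp.mem hC
  have key : ∀ w ∈ polar C, ⟪(p : E3), w⟫ = 0 → 0 ≤ ⟪τ, w⟫ := fun w hw hpw => by
    by_cases h0 : w = 0
    · simp [h0]
    have := hτ (direction w h0) (supportsAt_of_inner_eq_zero (direction_mem_polar hw h0) hpC (by
      rw [coe_direction, real_inner_smul_right, hpw, mul_zero]))
    rw [coe_direction, real_inner_smul_right] at this
    exact nonneg_of_mul_nonneg_right this (inv_pos.2 (norm_pos_iff.2 h0))
  have h1 : ⟪(p : E3), u⟫ + ⟪(p : E3), v⟫ = 0 := by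
    rw [← inner_add_right, huv, hp.inner_eq_zero]
  have h2 : ⟪τ, u⟫ + ⟪τ, v⟫ = 0 := by
    rw [← inner_add_right, huv, real_inner_comm, hF.ef]
  have hpu := hu p hpC
  have hpv := hv p hpC
  -- Two non-negative numbers with sum zero vanish; the same argument then applies to `τ`, since
  -- both summands now support at `p`.
  have hpu0 : ⟪(p : E3), u⟫ = 0 := by linarith
  have h3 := key u hu hpu0
  have h4 := key v hv (by linarith)
  have hτu : ⟪τ, u⟫ = 0 := by linarith
  conv_lhs => rw [hF.eq_sum u]
  rw [hτu, hpu0, zero_smul, zero_smul, add_zero, add_zero]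

/-! ### Incompatible perpendicular chords -/

lemma mul_lt_mul_of_sq_lt {C S x p : ℝ} (hC : 0 < C) (hCS : C ^ 2 + S ^ 2 = 1)
    (hp : 0 < p) (h : x ^ 2 < C ^ 2 * (x ^ 2 + p ^ 2)) : S * (-x) < C * p := by
  refine lt_of_pow_lt_pow_left₀ 2 (by positivity) ?_
  have : S ^ 2 = 1 - C ^ 2 := by linarith
  rw [mul_pow, mul_pow, this]
  linarith

lemma mul_le_mul_of_sq_le {C S x p : ℝ} (hC : 0 < C) (hCS : C ^ 2 + S ^ 2 = 1)
    (hp : 0 < p) (h : x ^ 2 ≤ C ^ 2 * (x ^ 2 + p ^ 2)) : S * (-x) ≤ C * p := by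
  refine le_of_abs_le (abs_le_of_sq_le_sq ?_ (by positivity))
  have : S ^ 2 = 1 - C ^ 2 := by linarith
  rw [mul_pow, mul_pow, this]
  linarith

lemma neg_of_mul_add_mul_eq_zero {x p s t : ℝ} (h : x * s + p * t = 0) (hp : 0 < p) (ht : 0 < t)
    (hs : 0 ≤ s) : x < 0 ∧ 0 < s := by
  have hpt := mul_pos hp ht
  have hx : x < 0 := by
    by_contra! h'
    linarith [mul_nonneg h' hs]
  refine ⟨hx, lt_of_le_of_ne hs fun h' => ?_⟩
  rw [← h', mul_zero] at h
  linarith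

/-- A bound on the slope of `(x, p)` passes to its normal `(s, t)`. A distance bound for a vector of
the cone thus becomes a bound on the supporting normal `s`. -/
lemma mul_lt_mul_of_orthogonal {C S x p s t : ℝ} (h : x * s + p * t = 0) (hp : 0 < p)
    (hs : 0 < s) (hx : S * (-x) < C * p) : S * t < C * s := by
  refine lt_of_mul_lt_mul_left ?_ hp.le
  calc p * (S * t) = S * (-x) * s := by linear_combination S * h
    _ < C * p * s := mul_lt_mul_of_pos_right hx hs
    _ = p * (C * s) := by ring

lemma mul_le_mul_of_orthogonal {C S x p s t : ℝ} (h : x * s + p * t = 0) (hp : 0 < p)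
    (hs : 0 < s) (hx : S * (-x) ≤ C * p) : S * t ≤ C * s := by
  refine le_of_mul_le_mul_left ?_ hp
  calc p * (S * t) = S * (-x) * s := by linear_combination S * h
    _ ≤ C * p * s := mul_le_mul_of_nonneg_right hx hs.le
    _ = p * (C * s) := by ring

/-- The case of `false_of_perpendicular_chords` in which the foot of `y` lies on the edge. -/
lemma false_of_foot_on_edge {C S yP sX sT sP : ℝ} (hC : 0 < C) (hS : 0 < S)
    (hCS : C ^ 2 + S ^ 2 = 1) (hss : sX * sX + sT * sT + sP * sP = 1)
    (hz : C * yP ≤ S * sP) (hsXP : S * sP < C * sX) (hyP : S ≤ yP) : False := by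
  have h5 : C ≤ sP := by
    refine le_of_mul_le_mul_left ?_ hS
    linarith [mul_le_mul_of_nonneg_left hyP hC.le]
  have h6 : S < sX := by
    refine lt_of_mul_lt_mul_left ?_ hC.le
    linarith [mul_le_mul_of_nonneg_left h5 hS.le]
  have h7 := mul_self_lt_mul_self hS.le h6
  have h8 := mul_self_le_mul_self hC.le h5
  linarith [mul_self_nonneg sT, sq C, sq S]

/-- The case of `false_of_perpendicular_chords` in which the foot of `y` lies beyond the edge. -/
lemma false_of_foot_beyond_edge {C S yX yT yP sX sT sP aX aT : ℝ} (hC : 0 < C) (hS : 0 < S)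
    (haa : aX * aX + aT * aT = 1) (haT : 0 < aT)
    (hsXP : S * sP < C * sX) (h4 : S * sP ≤ C * (aX * sX + aT * sT))
    (hsb : C * (aX * sX + aT * sT) ≤ S * sP) (hsa : 0 < aX * sX + aT * sT)
    (hsy : yX * sX + yT * sT + yP * sP = 0)
    (hby : 0 ≤ S * (aX * yX + aT * yT) + C * yP) (hh : 0 < yX * aT - yT * aX) : False := by
  obtain ⟨sa, hsa'⟩ : ∃ t, t = aX * sX + aT * sT := ⟨_, rfl⟩
  obtain ⟨sh, hsh⟩ : ∃ t, t = aT * sX - aX * sT := ⟨_, rfl⟩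
  -- The two opposite bounds make `s` orthogonal to `b`. Its part in the plane of `a` and `p` is
  -- then a positive multiple of `S a + C p`, which is non-negative on `y`; since `s` is orthogonal
  -- to `y`, the remaining coordinate `sh` must be non-positive.
  rw [← hsa'] at h4 hsb hsa
  have h5 : S * sP = C * sa := le_antisymm h4 hsb
  have i1 : (aX * yX + aT * yT) * sa + yP * sP + (yX * aT - yT * aX) * sh = 0 := by
    rw [hsa', hsh]
    linear_combination hsy + (yX * sX + yT * sT) * haa
  have i2 : S * ((aX * yX + aT * yT) * sa + yP * sP) =
      sa * (S * (aX * yX + aT * yT) + C * yP) := by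
    linear_combination yP * h5
  have i3 : 0 ≤ S * ((aX * yX + aT * yT) * sa + yP * sP) := i2 ▸ mul_nonneg hsa.le hby
  have i4 := nonneg_of_mul_nonneg_right i3 hS
  have h7 : sh ≤ 0 := by
    by_contra! h'
    linarith [mul_pos hh h']
  have h8 : sX = aX * sa + aT * sh := by
    rw [hsa', hsh]; linear_combination -sX * haa
  have h9 : aX ≤ 1 := by
    by_contra! h'
    linarith [mul_self_lt_mul_self zero_le_one h', mul_pos haT haT]
  have h10 : sX ≤ sa := by
    linarith [mul_nonneg haT.le (neg_nonneg.2 h7), mul_le_mul_of_nonneg_right h9 hsa.le]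
  linarith [mul_le_mul_of_nonneg_left h10 hC.le]

/-- The local contradiction at a vertex `m` of the dual body at which an edge `m a` begins: a chord
from `y` to `-C y + S s` perpendicular at `y` to the great circle orthogonal to `s` cannot have the
same length as the chord from `a` to `b = -C a + S p` that is perpendicular to the edge. -/
lemma false_of_perpendicular_chords {K : Set E3} {C S : ℝ} (hC : 0 < C) (hS : 0 < S)
    (hCS : C ^ 2 + S ^ 2 = 1)
    (hadd : ∀ u ∈ K, ∀ v ∈ K, u + v ∈ K) (hsmul : ∀ t : ℝ, 0 ≤ t → ∀ u ∈ K, t • u ∈ K)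
    {m τ p a n s y : E3} (hF : IsFrame m τ p)
    (hK : ∀ u ∈ K, ∀ v ∈ K, ⟪u, v⟫ < 0 → ⟪u, v⟫ ^ 2 ≤ C ^ 2 * (⟪u, u⟫ * ⟪v, v⟫))
    (hmK : ∀ u ∈ K, ⟪m, u⟫ < 0 → ⟪m, u⟫ ^ 2 < C ^ 2 * ⟪u, u⟫)
    (hm : m ∈ K) (ha : a ∈ K) (haa : ⟪a, a⟫ = 1) (hpa : ⟪p, a⟫ = 0) (hτa : 0 < ⟪τ, a⟫)
    (hb : -C • a + S • p ∈ K) (hb' : ∀ u ∈ K, 0 ≤ S * ⟪a, u⟫ + C * ⟪p, u⟫)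
    (hp : ∀ u ∈ K, 0 ≤ ⟪p, u⟫) (hs : ∀ u ∈ K, 0 ≤ ⟪s, u⟫) (hss : ⟪s, s⟫ = 1)
    (hedge : ∀ u ∈ K, ⟪p, u⟫ = 0 → 0 ≤ ⟪τ, u⟫)
    (hn : n ∈ K) (hτn : 0 < ⟪τ, n⟫) (hpn : 0 < ⟪p, n⟫) (hsn : ⟪s, n⟫ = 0)
    (hy : y ∈ K) (hyy : ⟪y, y⟫ = 1) (hsy : ⟪s, y⟫ = 0) (hz : -C • y + S • s ∈ K)
    (hτy : ⟪τ, y⟫ < 0) : False := by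
  have hsm := hs m hm
  have hsa := hs a ha
  have hsb := hs _ hb
  have hby := hb' y hy
  have hpz := hp _ hz
  have hpy0 : 0 < ⟪p, y⟫ := lt_of_le_of_ne (hp y hy) fun h => (hedge y hy h.symm).not_gt hτy
  have hτm : ⟪τ, m⟫ = 0 := by rw [real_inner_comm]; exact hF.ef
  have hpm : ⟪p, m⟫ = 0 := by rw [real_inner_comm]; exact hF.eg
  rw [inner_add_right, real_inner_smul_right, real_inner_smul_right] at hsb hpz
  rw [real_inner_comm] at hsm
  have hyy' := hyy
  have haa' := haa
  rw [hF.inner_eq] at haa hss hyy hsy hsn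
  rw [hF.inner_eq s a, real_inner_comm p s, hpa] at hsb
  rw [hF.inner_eq s a, hpa] at hsa
  rw [hF.inner_eq a y, hpa] at hby
  rw [hpa] at haa
  -- The coefficients cancel the `τ`-component: this is where the arc from `y` to `n` crosses the
  -- great circle through `m` and `p`. Being closer to `m` than the diameter yields `hsXP`.
  have hv0 := hadd _ (hsmul _ hτn.le y hy) _ (hsmul _ (neg_nonneg.2 hτy.le) n hn)
  have hv0m := hmK _ hv0
  have hFv0 : ∀ w : E3, ⟪w, ⟪τ, n⟫ • y + -⟪τ, y⟫ • n⟫ =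
      ⟪τ, n⟫ * ⟪w, y⟫ - ⟪τ, y⟫ * ⟪w, n⟫ := fun w => by
    rw [inner_add_right, real_inner_smul_right, real_inner_smul_right]; ring
  rw [hF.inner_eq (⟪τ, n⟫ • y + -⟪τ, y⟫ • n) (⟪τ, n⟫ • y + -⟪τ, y⟫ • n)] at hv0m
  simp only [hFv0] at hv0m
  obtain ⟨vX, hvX⟩ : ∃ t, t = ⟪τ, n⟫ * ⟪m, y⟫ - ⟪τ, y⟫ * ⟪m, n⟫ := ⟨_, rfl⟩
  obtain ⟨vP, hvP⟩ : ∃ t, t = ⟪τ, n⟫ * ⟪p, y⟫ - ⟪τ, y⟫ * ⟪p, n⟫ := ⟨_, rfl⟩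
  rw [← hvX, ← hvP] at hv0m
  have hCy : C * ⟪p, y⟫ ≤ S * ⟪p, s⟫ := by linarith
  have hsP0 : 0 < ⟪p, s⟫ :=
    (mul_pos_iff_of_pos_left hS).1 ((mul_pos hC hpy0).trans_le hCy)
  have hvP0 : 0 < vP := by
    rw [hvP]; linarith [mul_pos hτn hpy0, mul_pos (neg_pos.2 hτy) hpn]
  have hvs : vX * ⟪m, s⟫ + vP * ⟪p, s⟫ = 0 := by
    rw [hvX, hvP]; linear_combination ⟪τ, n⟫ * hsy - ⟪τ, y⟫ * hsn
  obtain ⟨hvX0, hsX0⟩ := neg_of_mul_add_mul_eq_zero hvs hvP0 hsP0 hsm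
  have hv : vX ^ 2 < C ^ 2 * (vX ^ 2 + vP ^ 2) := by
    refine (hv0m hvX0).trans_eq ?_
    ring
  have hsXP : S * ⟪p, s⟫ < C * ⟪m, s⟫ :=
    mul_lt_mul_of_orthogonal hvs hvP0 hsX0 (mul_lt_mul_of_sq_lt hC hCS hvP0 hv)
  rcases le_or_gt (⟪m, y⟫ * ⟪τ, a⟫ - ⟪τ, y⟫ * ⟪m, a⟫) 0 with hcase | hcase
  · refine false_of_foot_on_edge hC hS hCS hss hCy hsXP ?_
    -- This vector is a negative multiple of the projection of `y` to the plane of the edge. It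
    -- represents the point of the edge's great circle farthest from `y`, so the diameter bound
    -- forces `S ≤ ⟪p, y⟫`.
    have hG := hadd _ (hsmul _ (neg_nonneg.2 hcase) m hm) _ (hsmul _ (neg_nonneg.2 hτy.le) a ha)
    have hFG : ∀ w : E3, ⟪w, -(⟪m, y⟫ * ⟪τ, a⟫ - ⟪τ, y⟫ * ⟪m, a⟫) • m + -⟪τ, y⟫ • a⟫ =
        -(⟪m, y⟫ * ⟪τ, a⟫ - ⟪τ, y⟫ * ⟪m, a⟫) * ⟪w, m⟫ - ⟪τ, y⟫ * ⟪w, a⟫ := fun w => by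
      rw [inner_add_right, real_inner_smul_right, real_inner_smul_right]; ring
    have h1 := hK y hy _ hG
    rw [hF.inner_eq y, hF.inner_eq (_ + _), hyy'] at h1
    simp only [hFG, hF.ee, hτm, hpm, hpa] at h1
    obtain ⟨ρ, hρ'⟩ : ∃ t, t = ⟪m, y⟫ * ⟪m, y⟫ + ⟪τ, y⟫ * ⟪τ, y⟫ := ⟨_, rfl⟩
    have hρ : 0 < ρ := by
      rw [hρ']; exact add_pos_of_nonneg_of_pos (mul_self_nonneg _) (mul_pos_of_neg_of_neg hτy hτy)
    have h2 : (⟪τ, a⟫ * ρ) ^ 2 ≤ C ^ 2 * (⟪τ, a⟫ ^ 2 * ρ) := by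
      refine le_of_eq_of_le ?_ ((h1 ?_).trans_eq ?_)
      · rw [hρ']; ring
      · refine lt_of_eq_of_lt ?_ (neg_lt_zero.2 (mul_pos hτa hρ))
        rw [hρ']; ring
      · rw [hρ']; ring
    have h3 : ρ ≤ C ^ 2 := by
      have hq : 0 < ⟪τ, a⟫ ^ 2 * ρ := by positivity
      refine le_of_mul_le_mul_left ?_ hq
      linarith
    refine le_of_abs_le (abs_le_of_sq_le_sq ?_ hpy0.le)
    rw [← hρ'] at hyy
    linarith [sq ⟪p, y⟫]
  · have hvh : vX * ⟪τ, a⟫ < 0 := mul_neg_of_neg_of_pos hvX0 hτa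
    -- Here the arc from `y` to `n` is followed to the great circle through `a` and `p`, where the
    -- distance to `a` is bounded by the diameter.
    have hv1 := hadd _ (hsmul _ hcase.le _ hv0) _ (hsmul _ (neg_nonneg.2 hvh.le) y hy)
    obtain ⟨h, hh⟩ : ∃ t, t = ⟪m, y⟫ * ⟪τ, a⟫ - ⟪τ, y⟫ * ⟪m, a⟫ := ⟨_, rfl⟩
    rw [← hh] at hcase hv1
    have hFv1 : ∀ w : E3, ⟪w, h • (⟪τ, n⟫ • y + -⟪τ, y⟫ • n) + -(vX * ⟪τ, a⟫) • y⟫ =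
        h * (⟪τ, n⟫ * ⟪w, y⟫ - ⟪τ, y⟫ * ⟪w, n⟫) - vX * ⟪τ, a⟫ * ⟪w, y⟫ := fun w => by
      rw [inner_add_right, real_inner_smul_right, real_inner_smul_right, hFv0]; ring
    have h1 := hK a ha _ hv1
    rw [hF.inner_eq a, hF.inner_eq (_ + _), haa'] at h1
    simp only [hFv1, hpa, ← hvX, ← hvP] at h1
    obtain ⟨wX, hwX⟩ : ∃ t, t = h * vX - vX * ⟪τ, a⟫ * ⟪m, y⟫ := ⟨_, rfl⟩
    obtain ⟨wT, hwT⟩ : ∃ t, t = h * (⟪τ, n⟫ * ⟪τ, y⟫ - ⟪τ, y⟫ * ⟪τ, n⟫) -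
      vX * ⟪τ, a⟫ * ⟪τ, y⟫ := ⟨_, rfl⟩
    obtain ⟨wP, hwP⟩ : ∃ t, t = h * vP - vX * ⟪τ, a⟫ * ⟪p, y⟫ := ⟨_, rfl⟩
    rw [← hwX, ← hwT, ← hwP] at h1
    have haa1 : ⟪m, a⟫ * ⟪m, a⟫ + ⟪τ, a⟫ * ⟪τ, a⟫ = 1 := by linarith
    have hw0 : ⟪τ, a⟫ * wX - ⟪m, a⟫ * wT = 0 := by rw [hwX, hwT, hh]; ring
    have hwP0 : 0 < wP := by
      rw [hwP]
      linarith [mul_pos hcase hvP0, mul_pos (neg_pos.2 hvh) hpy0]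
    obtain ⟨wa, hwa⟩ : ∃ t, t = ⟪m, a⟫ * wX + ⟪τ, a⟫ * wT := ⟨_, rfl⟩
    have hww : wX * wX + wT * wT = wa ^ 2 := by
      rw [hwa]
      linear_combination -(wX * wX + wT * wT) * haa1 + (⟪τ, a⟫ * wX - ⟪m, a⟫ * wT) * hw0
    have hws : wa * (⟪m, a⟫ * ⟪m, s⟫ + ⟪τ, a⟫ * ⟪τ, s⟫) + wP * ⟪p, s⟫ = 0 := by
      have i1 : wX * ⟪m, s⟫ + wT * ⟪τ, s⟫ + wP * ⟪p, s⟫ = 0 := by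
        rw [hwX, hwT, hwP]
        linear_combination h * hvs - vX * ⟪τ, a⟫ * hsy
      rw [hwa]
      linear_combination i1 + (wX * ⟪m, s⟫ + wT * ⟪τ, s⟫) * haa1 -
        (⟪τ, a⟫ * ⟪m, s⟫ - ⟪m, a⟫ * ⟪τ, s⟫) * hw0
    obtain ⟨hwa0, hsa0⟩ := neg_of_mul_add_mul_eq_zero hws hwP0 hsP0 (by linarith)
    have h2 : wa ^ 2 ≤ C ^ 2 * (wa ^ 2 + wP ^ 2) := by
      rw [hww, zero_mul, add_zero, ← hwa] at h1
      refine (h1 hwa0).trans_eq ?_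
      ring
    exact false_of_foot_beyond_edge (yP := ⟪p, y⟫) hC hS haa1 hτa hsXP
      (mul_le_mul_of_orthogonal hws hwP0 hsa0 (mul_le_mul_of_sq_le hC hCS hwP0 h2))
      (by linarith) hsa0 (by linarith) (by linarith) (hh ▸ hcase)

/-! ### Edges of the dual body at an extreme point -/

lemma exists_frame_of_ne {m p a : S2} (hpm : ⟪(p : E3), (m : E3)⟫ = 0)
    (hpa : ⟪(p : E3), (a : E3)⟫ = 0) (h1 : a ≠ m) (h2 : a ≠ -m) :
    ∃ τ : E3, IsFrame (m : E3) τ (p : E3) ∧ 0 < ⟪τ, (a : E3)⟫ := by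
  have h0 := sub_smul_ne_zero h1 h2 ⟪(a : E3), (m : E3)⟫
  have hlt := inner_lt_one h1
  have hgt : -1 < ⟪(a : E3), (m : E3)⟫ :=
    lt_of_le_of_ne (neg_one_le_inner a m) fun h => h2 ((inner_eq_neg_one_iff a m).1 h.symm)
  refine ⟨direction _ h0, ⟨inner_self_sphere m, inner_self_sphere _, inner_self_sphere p, ?_, ?_, ?_⟩, ?_⟩
  · rw [real_inner_comm, coe_direction, real_inner_smul_left, inner_sub_smul_self, mul_zero]
  · rw [real_inner_comm]; exact hpm
  · rw [coe_direction, real_inner_smul_left, inner_sub_left, real_inner_smul_left,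
      real_inner_comm (p : E3) (a : E3), real_inner_comm (p : E3) (m : E3), hpm, hpa]
    ring
  · rw [coe_direction, real_inner_smul_left, inner_sub_left, real_inner_smul_left,
      inner_self_sphere, real_inner_comm (a : E3) (m : E3)]
    refine mul_pos (inv_pos.2 (norm_pos_iff.2 h0)) ?_
    nlinarith

/-- If an edge of the dual body starts at its extreme point `m`, then it leads only to one side. -/
lemma IsExtremeSupporting.inner_nonneg_of_edge {R : Set S2} (hR : IsBody R) {m : S2}
    (hm : IsExtremeSupporting R m) (hmR : (m : E3) ∈ polar R) {τ p a : E3}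
    (hF : IsFrame (m : E3) τ p) (ha : a ∈ polar R) (hpa : ⟪p, a⟫ = 0) (hτa : 0 < ⟪τ, a⟫)
    {u : E3} (hu : u ∈ polar R) (hpu : ⟪p, u⟫ = 0) : 0 ≤ ⟪τ, u⟫ := by
  by_contra! hlt
  have hu1 := smul_mem_polar hτa.le hu
  have ha1 := smul_mem_polar (neg_nonneg.2 hlt.le) ha
  have hw : -⟪τ, u⟫ • a + ⟪τ, a⟫ • u =
      (-⟪τ, u⟫ * ⟪(m : E3), a⟫ + ⟪τ, a⟫ * ⟪(m : E3), u⟫) • (m : E3) := by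
    conv_lhs => rw [hF.eq_sum (-⟪τ, u⟫ • a + ⟪τ, a⟫ • u)]
    simp only [inner_add_right, real_inner_smul_right, hpa, hpu]
    have : -⟪τ, u⟫ * ⟪τ, a⟫ + ⟪τ, a⟫ * ⟪τ, u⟫ = 0 := by ring
    rw [this]
    simp
  have hwR := add_mem_polar ha1 hu1
  have ha0 : -⟪τ, u⟫ • a ≠ 0 := by
    intro h
    have : ⟪τ, -⟪τ, u⟫ • a⟫ = 0 := by rw [h, inner_zero_right]
    rw [real_inner_smul_right] at this
    exact (mul_pos (neg_pos.2 hlt) hτa).ne' this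
  set l := -⟪τ, u⟫ * ⟪(m : E3), a⟫ + ⟪τ, a⟫ * ⟪(m : E3), u⟫
  -- The combination of `a` and `u` without `τ`-component is `l • m`. For `l ≤ 0` the dual cone
  -- would contain a line; for `l > 0`, `m` would lie inside an edge.
  rcases lt_trichotomy l 0 with hl | hl | hl
  · refine neg_notMem_polar hR (smul_mem_polar (neg_nonneg.2 hl.le) hmR)
      (smul_ne_zero (neg_ne_zero.2 hl.ne) (sphere_ne_zero m)) ?_
    rw [neg_smul, neg_neg, ← hw]; exact hwR
  · refine neg_notMem_polar hR ha1 ha0 ?_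
    rw [hl, zero_smul] at hw
    rw [neg_eq_of_add_eq_zero_right hw]; exact hu1
  · have h1 := hm.eq_smul_of_add_eq hR (smul_mem_polar (inv_nonneg.2 hl.le) ha1)
      (smul_mem_polar (inv_nonneg.2 hl.le) hu1)
      (by rw [← smul_add, hw, inv_smul_smul₀ hl.ne'])
    have h2 := congrArg (fun v => ⟪τ, v⟫) h1
    simp only [real_inner_smul_right] at h2
    rw [real_inner_comm (m : E3) τ, hF.ef, mul_zero] at h2
    exact (mul_pos (inv_pos.2 hl) (mul_pos (neg_pos.2 hlt) hτa)).ne' h2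

/-- Moving away from `m`, one leaves the dual cone at a vector orthogonal to a point of the body. -/
lemma exists_orthogonal_sub_smul {R : Set S2} (hR : IsBody R) {m : S2}
    (hm : (m : E3) ∈ polar R) {e : E3} (he : e ∈ polar R) :
    ∃ t : ℝ, e - t • (m : E3) ∈ polar R ∧ ∃ s ∈ R, ⟪(s : E3), e - t • (m : E3)⟫ = 0 := by
  set T := {t : ℝ | e - t • (m : E3) ∈ polar R} with hT
  have hclosed : IsClosed T := (isClosed_polar R).preimage (by fun_prop)
  have hne : T.Nonempty := ⟨0, by simpa [hT] using he⟩
  obtain ⟨r, hr, -, hpos⟩ := exists_interior_inner_pos hR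
  have hrm := hpos m hm (sphere_ne_zero m)
  have hbdd : BddAbove T := ⟨⟪(r : E3), e⟫ / ⟪(r : E3), (m : E3)⟫, fun t ht => by
    have := ht r hr
    rw [inner_sub_right, real_inner_smul_right] at this
    rw [le_div_iff₀ hrm]; linarith⟩
  have hmem : sSup T ∈ T := hclosed.csSup_mem hne hbdd
  refine ⟨sSup T, hmem, ?_⟩
  by_contra! h
  obtain ⟨s, hs, hmin⟩ := (isCompact_of_isBody hR).exists_isMinOn ⟨r, hr⟩
    (f := fun s : S2 => ⟪(s : E3), e - sSup T • (m : E3)⟫)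
    ((continuous_subtype_val.inner continuous_const).continuousOn)
  -- If no point of `R` were orthogonal, the positive minimum `δ` would allow a further step of
  -- length `δ`, because `⟪q, m⟫ ≤ 1`.
  set δ := ⟪(s : E3), e - sSup T • (m : E3)⟫ with hδ
  have hδ0 : 0 < δ := lt_of_le_of_ne (hmem s hs) (h s hs).symm
  have : sSup T + δ ∈ T := fun q hq => by
    have h1 : δ ≤ ⟪(q : E3), e - sSup T • (m : E3)⟫ := hmin hq
    rw [add_smul, ← sub_sub, inner_sub_right, real_inner_smul_right]
    nlinarith [inner_le_one q m]
  linarith [le_csSup hbdd this]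

/-- A point of the body at which a lune of minimal thickness touches is not determined by the
supporting hemisphere `H(m)` if all lunes bounded by `H(m)` are thicker. -/
lemma exists_two_minimal_lunes {R : Set S2} (hR : IsReduced R) {κ : ℝ}
    (hκ : thickness R = Real.pi - Real.arccos κ)
    (hmin : ∀ u v : S2, (u : E3) ∈ polar R → (v : E3) ∈ polar R → κ ≤ ⟪(u : E3), (v : E3)⟫)
    {m : S2} (hm : IsExtremeSupporting R m) (hmR : (m : E3) ∈ polar R)
    (hne : ∀ a c : S2, ⟪(c : E3), (a : E3)⟫ = 0 → ⟪(c : E3), (m : E3)⟫ = 0 →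
      κ • (a : E3) + √(1 - κ ^ 2) • (c : E3) ∈ polar R → a ≠ m)
    {p : S2} (hp : p ∈ R) (hpm : ⟪(p : E3), (m : E3)⟫ = 0) :
    ∃ a₁ p₁ a₂ p₂ : S2, p₁ ≠ p₂ ∧
      ((a₁ : E3) ∈ polar R ∧ p₁ ∈ R ∧ ⟪(p₁ : E3), (a₁ : E3)⟫ = 0 ∧ ⟪(p₁ : E3), (m : E3)⟫ = 0 ∧
        κ • (a₁ : E3) + √(1 - κ ^ 2) • (p₁ : E3) ∈ polar R) ∧
      ((a₂ : E3) ∈ polar R ∧ p₂ ∈ R ∧ ⟪(p₂ : E3), (a₂ : E3)⟫ = 0 ∧ ⟪(p₂ : E3), (m : E3)⟫ = 0 ∧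
        κ • (a₂ : E3) + √(1 - κ ^ 2) • (p₂ : E3) ∈ polar R) := by
  obtain ⟨a₂, p₂, ha₂, hp₂, hpa₂, hpm₂, hb₂⟩ := exists_minimal_lune hR hκ hmin hmR hp hpm
  obtain ⟨τ, hF, hτa₂⟩ := exists_frame_of_ne hpm₂ hpa₂ (hne a₂ p₂ hpa₂ hpm₂ hb₂)
    (ne_neg_of_mem_polar hR.1 ha₂ hmR)
  have hτm : ⟪τ, (m : E3)⟫ = 0 := by rw [real_inner_comm]; exact hF.ef
  have hpτ : ⟪(p₂ : E3), τ⟫ = 0 := by rw [real_inner_comm]; exact hF.fg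
  have hedge : ∀ u ∈ polar R, ⟪(p₂ : E3), u⟫ = 0 → 0 ≤ ⟪τ, u⟫ := fun u hu hpu =>
    hm.inner_nonneg_of_edge hR.1 hmR hF ha₂ hpa₂ hτa₂ hu hpu
  set ε : ℕ → ℝ := fun i => 1 / ((i : ℝ) + 1) with hε
  have hε0 : ∀ i, 0 < ε i := fun i => by positivity
  have hεlim : Tendsto ε atTop (𝓝 0) := tendsto_one_div_add_atTop_nhds_zero_nat
  -- These points lie on the great circle of the first edge, beyond `m`, hence outside the dual
  -- cone.
  have hx : Tendsto (fun i => (m : E3) - ε i • τ) atTop (𝓝 (m : E3)) := by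
    have := tendsto_const_nhds (x := (m : E3)).sub (hεlim.smul_const τ)
    simpa using this
  obtain ⟨φ, y, c, a₁, p₁, hφ, hya, hcp, hyc, ha₁, hp₁, hpa₁, hpm₁, hb₁⟩ :=
    exists_limit_lune hR hκ hmin hmR hx fun i h => by
      have h1 := hedge _ h (by
        rw [inner_sub_right, real_inner_smul_right, hpm₂, hpτ]; ring)
      rw [inner_sub_right, real_inner_smul_right, hτm, hF.ff] at h1
      linarith [hε0 i]
  refine ⟨a₁, p₁, a₂, p₂, ?_, ⟨ha₁, hp₁, hpa₁, hpm₁, hb₁⟩, ha₂, hp₂, hpa₂, hpm₂, hb₂⟩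
  -- If the second circle were the same, orthogonality of `c i` and `y i` would eventually put `y i`
  -- on this circle, on the side of the edge. There even the points of `R` that were cut off have
  -- non-negative inner product with `y i`, so `y i` would not be new.
  rintro rfl
  have hτa₁ : 0 < ⟪τ, (a₁ : E3)⟫ := by
    refine lt_of_le_of_ne (hedge _ ha₁ hpa₁) fun h => ?_
    have h1 := hF.inner_eq (a₁ : E3) (a₁ : E3)
    rw [← h, hpa₁, inner_self_sphere] at h1
    have h2 := inner_lt_one (hne a₁ p₁ hpa₁ hpm₁ hb₁)
    have h3 := neg_one_lt_inner hR.1 ha₁ hmR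
    rw [real_inner_comm] at h2 h3
    nlinarith
  have hya' := (continuous_subtype_val.tendsto a₁).comp hya
  have hcp' := (continuous_subtype_val.tendsto p₁).comp hcp
  have hlim1 : Tendsto (fun i => ⟪τ, (y i : E3)⟫ - ε (φ i) * |⟪(m : E3), (y i : E3)⟫|) atTop
      (𝓝 (⟪τ, (a₁ : E3)⟫ - 0 * |⟪(m : E3), (a₁ : E3)⟫|)) :=
    (Tendsto.inner (𝕜 := ℝ) tendsto_const_nhds hya').sub
      ((hεlim.comp hφ).mul (Tendsto.inner (𝕜 := ℝ) tendsto_const_nhds hya').abs)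
  have hlim2 : Tendsto (fun i => ⟪(p₁ : E3), (c i : E3)⟫) atTop (𝓝 ⟪(p₁ : E3), (p₁ : E3)⟫) :=
    Tendsto.inner (𝕜 := ℝ) tendsto_const_nhds hcp'
  rw [inner_self_sphere] at hlim2
  rw [zero_mul, sub_zero] at hlim1
  obtain ⟨i, hi1, hi2⟩ := ((hlim1.eventually (lt_mem_nhds hτa₁)).and
    (hlim2.eventually (lt_mem_nhds zero_lt_one))).exists
  obtain ⟨hycut, hyR, hcR, hxc, hcy⟩ := hyc i
  refine hyR fun r hr => ?_
  have hε0 := hε0 (φ i)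
  set ε := ε (φ i)
  have hyX := neg_abs_le ⟪(m : E3), (y i : E3)⟫
  rw [inner_sub_left, real_inner_smul_left] at hxc
  have hcX := hmR (c i) hcR
  rw [real_inner_comm] at hcX
  have hcT : 0 ≤ ⟪τ, (c i : E3)⟫ := by
    by_contra! h
    nlinarith [mul_neg_of_pos_of_neg hε0 h]
  have hyP : 0 ≤ ⟪(p₁ : E3), (y i : E3)⟫ := hycut p₁ ⟨hp₁, by
    change 0 ≤ ⟪_, _⟫
    rw [inner_sub_left, real_inner_smul_left, hF.eg, hF.fg]
    simp⟩
  rw [hF.inner_eq] at hcy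
  have h1 : 0 ≤ ⟪τ, (c i : E3)⟫ * (ε * ⟪(m : E3), (y i : E3)⟫ + ⟪τ, (y i : E3)⟫) := by
    refine mul_nonneg hcT ?_
    nlinarith
  have h2 : ⟪(p₁ : E3), (c i : E3)⟫ * ⟪(p₁ : E3), (y i : E3)⟫ ≤ 0 := by
    have : ⟪(m : E3), (c i : E3)⟫ = ε * ⟪τ, (c i : E3)⟫ := by linarith
    rw [this] at hcy
    linarith
  have h3 : ⟪(p₁ : E3), (y i : E3)⟫ = 0 :=
    le_antisymm (nonpos_of_mul_nonpos_right h2 hi2) hyP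
  by_cases hrx : 0 ≤ ⟪(m : E3) - ε • τ, (r : E3)⟫
  · exact hycut r ⟨hr, hrx⟩
  · rw [inner_sub_left, real_inner_smul_left] at hrx
    push Not at hrx
    have hrX := hmR r hr
    rw [real_inner_comm] at hrX
    rw [hF.inner_eq, h3, mul_zero, add_zero]
    have hrT : 0 < ⟪τ, (r : E3)⟫ := by
      by_contra! h
      linarith [mul_nonneg hε0.le (neg_nonneg.2 h)]
    have i1 : ⟪τ, (r : E3)⟫ * (ε * |⟪(m : E3), (y i : E3)⟫|) ≤
        ⟪τ, (r : E3)⟫ * ⟪τ, (y i : E3)⟫ := mul_le_mul_of_nonneg_left (by linarith) hrT.le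
    have i2 : ⟪(m : E3), (r : E3)⟫ * |⟪(m : E3), (y i : E3)⟫| ≤
        ε * ⟪τ, (r : E3)⟫ * |⟪(m : E3), (y i : E3)⟫| :=
      mul_le_mul_of_nonneg_right (by linarith) (abs_nonneg _)
    have i3 := mul_le_mul_of_nonneg_left hyX hrX
    linarith

/-! ### The global contradiction at a vertex with two edges -/

/-- Two orthonormal pairs in a plane that are positioned like the edges of an angle and their inner
normals. -/
lemma coordinates_of_normals {t w q q' : ℝ} (hq : 0 < q) (hq' : 0 < q')
    (h1 : q ^ 2 + w ^ 2 = 1) (h2 : t ^ 2 + q' ^ 2 = 1) (h : q * t + w * q' = 0) :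
    q' = q ∧ w = -t := by
  have e : t ^ 2 = w ^ 2 := by
    have : q ^ 2 * t ^ 2 = w ^ 2 * q' ^ 2 := by
      linear_combination (q * t - w * q') * h
    have e1 : q ^ 2 = 1 - w ^ 2 := by linarith
    have e2 : q' ^ 2 = 1 - t ^ 2 := by linarith
    rw [e1, e2] at this
    linarith
  have hqq : q' = q := by
    rw [← sq_eq_sq₀ hq'.le hq.le]; linarith
  refine ⟨hqq, ?_⟩
  rw [hqq] at h
  have : q * (t + w) = 0 := by linarith
  linarith [(mul_eq_zero.1 this).resolve_left hq.ne']

lemma lt_mul_of_lt_of_le_one {κ x y : ℝ} (hκ : κ < 0) (hx : κ < x) (hy : κ < y) (hx1 : x ≤ 1)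
    (hy1 : y ≤ 1) : κ < x * y := by
  rcases le_or_gt 0 y with h | h
  · rcases le_or_gt 0 x with h' | h'
    · linarith [mul_nonneg h' h]
    · nlinarith
  · rcases le_or_gt 0 x with h' | h'
    · nlinarith
    · linarith [mul_pos_of_neg_of_neg h' h]

/-- In a reduced body, an extreme supporting hemisphere bounds a lune of minimal thickness. -/
lemma IsReduced.exists_inner_le {R : Set S2} (hR : IsReduced R) {κ : ℝ} (hκ1 : -1 < κ) (hκ2 : κ < 1)
    (hκ : thickness R = Real.pi - Real.arccos κ)
    (hmin : ∀ u v : S2, (u : E3) ∈ polar R → (v : E3) ∈ polar R → κ ≤ ⟪(u : E3), (v : E3)⟫)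
    {m : S2} (hm : IsExtremeSupporting R m) :
    ∃ u : S2, (u : E3) ∈ polar R ∧ ⟪(m : E3), (u : E3)⟫ ≤ κ := by
  by_contra! hstrict
  obtain ⟨p, -, hmp, -⟩ := hm.exists_frame hR.1
  have hmR := hmp.mem_polar
  set S := √(1 - κ ^ 2) with hSdef
  have hS2 : S ^ 2 = 1 - κ ^ 2 := Real.sq_sqrt (by nlinarith)
  have hS : 0 < S := Real.sqrt_pos.2 (by nlinarith)
  have hunit : ∀ a c : S2, ⟪(c : E3), (a : E3)⟫ = 0 → ‖κ • (a : E3) + S • (c : E3)‖ = 1 := by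
    intro a c hca
    have hac : ⟪(a : E3), (c : E3)⟫ = 0 := by rw [real_inner_comm]; exact hca
    refine (pow_eq_one_iff_of_nonneg (norm_nonneg _) two_ne_zero).1 ?_
    rw [norm_add_sq_real, norm_smul, norm_smul, mul_pow, mul_pow, norm_coe_sphere, norm_coe_sphere,
      real_inner_smul_left, real_inner_smul_right, hac, Real.norm_eq_abs, Real.norm_eq_abs, sq_abs,
      sq_abs, hS2]
    ring
  have hmlow : ∀ u ∈ polar R, u ≠ 0 → κ * ‖u‖ < ⟪(m : E3), u⟫ := fun u hu h0 => by
    have := hstrict _ (direction_mem_polar hu h0)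
    rwa [coe_direction, real_inner_smul_right, inv_mul_eq_div,
      lt_div_iff₀ (norm_pos_iff.2 h0)] at this
  have hfoot : ∀ a c : S2, ⟪(c : E3), (a : E3)⟫ = 0 → ⟪(c : E3), (m : E3)⟫ = 0 →
      κ • (a : E3) + S • (c : E3) ∈ polar R → κ < κ * ⟪(m : E3), (a : E3)⟫ := by
    intro a c hca hcm hb
    have hn := hunit a c hca
    have h := hmlow _ hb (by rw [← norm_ne_zero_iff, hn]; exact one_ne_zero)
    rwa [hn, mul_one, inner_add_right, real_inner_smul_right, real_inner_smul_right,
      real_inner_comm (c : E3) (m : E3), hcm, mul_zero, add_zero] at h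
  -- `hfoot` reads `κ < κ * ⟪m, a⟫` with `⟪m, a⟫ ≤ 1`, which is impossible for `κ ≥ 0`.
  have hκ0 : κ < 0 := by
    obtain ⟨a, c, ha, -, hca, hcm, hb⟩ :=
      exists_minimal_lune hR hκ hmin hmR (hmp.mem hR.1) hmp.inner_eq_zero
    by_contra! h
    have := hfoot a c hca hcm hb
    nlinarith [inner_le_one m a]
  have hne : ∀ a c : S2, ⟪(c : E3), (a : E3)⟫ = 0 → ⟪(c : E3), (m : E3)⟫ = 0 →
      κ • (a : E3) + S • (c : E3) ∈ polar R → a ≠ m := by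
    rintro a c hca hcm hb rfl
    have := hfoot a c hca hcm hb
    rw [inner_self_sphere, mul_one] at this
    exact lt_irrefl _ this
  obtain ⟨a₁, p₁, a₂, p₂, hp12, ⟨ha₁, hp₁, hpa₁, hpm₁, hb₁⟩, ha₂, hp₂, hpa₂, hpm₂, hb₂⟩ :=
    exists_two_minimal_lunes hR hκ hmin hm hmR hne (hmp.mem hR.1) hmp.inner_eq_zero
  obtain ⟨τ₁, hF₁, hτa₁⟩ := exists_frame_of_ne hpm₁ hpa₁ (hne a₁ p₁ hpa₁ hpm₁ hb₁)
    (ne_neg_of_mem_polar hR.1 ha₁ hmR)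
  obtain ⟨τ₂, hF₂, hτa₂⟩ := exists_frame_of_ne hpm₂ hpa₂ (hne a₂ p₂ hpa₂ hpm₂ hb₂)
    (ne_neg_of_mem_polar hR.1 ha₂ hmR)
  have hmp₁ : ⟪(m : E3), (p₁ : E3)⟫ = 0 := hF₁.eg
  have hmp₂ : ⟪(m : E3), (p₂ : E3)⟫ = 0 := hF₂.eg
  have hp12' : p₁ ≠ -p₂ := by
    rintro rfl
    exact hR.1.2.1.1 p₂ hp₂ hp₁
  -- the plane orthogonal to `m`
  have hpos : ∀ (a p p' : S2) (τ : E3), IsFrame (m : E3) τ p → (a : E3) ∈ polar R →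
      0 < ⟪τ, (a : E3)⟫ → ⟪(p : E3), (a : E3)⟫ = 0 → p' ∈ R → ⟪(m : E3), (p' : E3)⟫ = 0 →
      p ≠ p' → p ≠ -p' → 0 < ⟪τ, (p' : E3)⟫ := by
    intro a p p' τ hF ha hτa hpa hp' hmp' h1 h2
    have h3 := hp' |> ha p'
    rw [hF.inner_eq, hmp', hpa] at h3
    have h4 : 0 ≤ ⟪τ, (p' : E3)⟫ := by
      by_contra! h
      linarith [mul_neg_of_neg_of_pos h hτa]
    refine lt_of_le_of_ne h4 fun h => ?_
    have h5 := hF.inner_eq (p' : E3) (p' : E3)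
    rw [hmp', ← h, inner_self_sphere] at h5
    have h6 : (⟪(p : E3), (p' : E3)⟫ - 1) * (⟪(p : E3), (p' : E3)⟫ + 1) = 0 := by linarith
    rcases mul_eq_zero.1 h6 with h6 | h6
    · exact h1 ((inner_eq_one_iff p p').1 (by linarith))
    · exact h2 ((inner_eq_neg_one_iff p p').1 (by linarith))
  have hq₁ := hpos a₁ p₁ p₂ τ₁ hF₁ ha₁ hτa₁ hpa₁ hp₂ hmp₂ hp12 hp12'
  have hq₂ := hpos a₂ p₂ p₁ τ₂ hF₂ ha₂ hτa₂ hpa₂ hp₁ hmp₁ hp12.symm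
    (fun h => hp12' (by rw [h, neg_neg]))
  have hτ₂sq := hF₁.inner_eq τ₂ τ₂
  have hp₂sq := hF₁.inner_eq (p₂ : E3) (p₂ : E3)
  have hp₂τ₂ := hF₁.inner_eq (p₂ : E3) τ₂
  rw [hF₂.ff, hF₂.ef] at hτ₂sq
  rw [inner_self_sphere, hmp₂] at hp₂sq
  rw [real_inner_comm, hF₂.fg, hmp₂, zero_mul, zero_add] at hp₂τ₂
  have hq₂' : 0 < ⟪(p₁ : E3), τ₂⟫ := by rw [real_inner_comm]; exact hq₂
  obtain ⟨hqq, hwt⟩ := coordinates_of_normals hq₁ hq₂' (t := ⟪τ₁, τ₂⟫)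
    (w := ⟪(p₁ : E3), (p₂ : E3)⟫) (by linarith) (by linarith) (by linarith)
  have ht : 0 < 1 + ⟪τ₁, τ₂⟫ := by nlinarith
  -- a boundary vector of the dual cone between the two normals
  have hexp : ∀ (a p : S2) (τ : E3), IsFrame (m : E3) τ p → ⟪(p : E3), (a : E3)⟫ = 0 →
      0 < ⟪τ, (a : E3)⟫ →
      ⟪τ, (a : E3)⟫⁻¹ • (a : E3) = (⟪τ, (a : E3)⟫⁻¹ * ⟪(m : E3), (a : E3)⟫) • (m : E3) + τ := by
    intro a p τ hF hpa hτa
    have h := congrArg (fun v => ⟪τ, (a : E3)⟫⁻¹ • v) (hF.eq_sum (a : E3))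
    simp only [hpa, zero_smul, add_zero, smul_add, smul_smul, inv_mul_cancel₀ hτa.ne',
      one_smul] at h
    exact h
  -- Scaled to unit `τ`-component, the edge vectors project along `m` to the unit vectors `τ₁` and
  -- `τ₂`. The vector `n` therefore projects to their bisecting direction, whatever `t` is.
  have hE := add_mem_polar (smul_mem_polar (inv_nonneg.2 hτa₁.le) ha₁)
    (smul_mem_polar (inv_nonneg.2 hτa₂.le) ha₂)
  obtain ⟨t, hnR, s₀, hs₀, hs₀n⟩ := exists_orthogonal_sub_smul hR.1 hmR hE
  rw [hexp a₁ p₁ τ₁ hF₁ hpa₁ hτa₁, hexp a₂ p₂ τ₂ hF₂ hpa₂ hτa₂] at hnR hs₀n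
  obtain ⟨n, hn⟩ : ∃ n : E3, n = (⟪τ₁, (a₁ : E3)⟫⁻¹ * ⟪(m : E3), (a₁ : E3)⟫) • (m : E3) + τ₁ +
    ((⟪τ₂, (a₂ : E3)⟫⁻¹ * ⟪(m : E3), (a₂ : E3)⟫) • (m : E3) + τ₂) - t • (m : E3) := ⟨_, rfl⟩
  rw [← hn] at hnR hs₀n
  have hinner : ∀ w : E3, ⟪w, (m : E3)⟫ = 0 → ⟪w, n⟫ = ⟪w, τ₁⟫ + ⟪w, τ₂⟫ := fun w hw => by
    simp only [hn, inner_sub_right, inner_add_right, real_inner_smul_right, hw]; ring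
  have hτ₁m : ⟪τ₁, (m : E3)⟫ = 0 := by rw [real_inner_comm]; exact hF₁.ef
  have hτ₂m : ⟪τ₂, (m : E3)⟫ = 0 := by rw [real_inner_comm]; exact hF₂.ef
  have hnτ₁ : 0 < ⟪τ₁, n⟫ := by rw [hinner _ hτ₁m, hF₁.ff]; exact ht
  have hnτ₂ : 0 < ⟪τ₂, n⟫ := by
    rw [hinner _ hτ₂m, hF₂.ff, real_inner_comm, add_comm]; exact ht
  have hnp₁ : 0 < ⟪(p₁ : E3), n⟫ := by
    rw [hinner _ hpm₁, real_inner_comm, hF₁.fg, zero_add]; exact hq₂'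
  have hnp₂ : 0 < ⟪(p₂ : E3), n⟫ := by
    rw [hinner _ hpm₂, real_inner_comm, real_inner_comm τ₂, hF₂.fg, add_zero]; exact hq₁
  have hn0 : n ≠ 0 := by
    intro h; rw [h, inner_zero_right] at hnτ₁; exact lt_irrefl _ hnτ₁
  obtain ⟨y, s, hy, hs, hsy, hsn, hz⟩ := exists_minimal_lune hR hκ hmin
    (k := direction n hn0) (direction_mem_polar hnR hn0) hs₀
    (by rw [coe_direction, real_inner_smul_right, hs₀n, mul_zero])
  rw [coe_direction, real_inner_smul_right] at hsn
  have hsn := (mul_eq_zero.1 hsn).resolve_left (inv_ne_zero (norm_ne_zero_iff.2 hn0))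
  have hKlow : ∀ u ∈ polar R, ∀ v ∈ polar R, κ * (‖u‖ * ‖v‖) ≤ ⟪u, v⟫ := fun u hu v hv => by
    have h1 : ∀ w : S2, (w : E3) ∈ polar R → κ * ‖u‖ ≤ ⟪u, (w : E3)⟫ := fun w hw => by
      rw [real_inner_comm]
      exact mul_norm_le_inner (fun x hx => hmin w x hw hx) hu
    have := mul_norm_le_inner h1 hv
    linarith
  have hside : ∀ (a p : S2) (τ : E3), IsFrame (m : E3) τ p → (a : E3) ∈ polar R → p ∈ R →
      0 < ⟪τ, (a : E3)⟫ → ⟪(p : E3), (a : E3)⟫ = 0 →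
      κ • (a : E3) + S • (p : E3) ∈ polar R → 0 < ⟪τ, n⟫ → 0 < ⟪(p : E3), n⟫ →
      0 ≤ ⟪τ, (y : E3)⟫ := by
    intro a p τ hF ha hp hτa hpa hb hnτ hnp
    by_contra! hlt
    refine false_of_perpendicular_chords (K := polar R) (C := -κ) (S := S) (neg_pos.2 hκ0) hS
      (by rw [hS2]; ring) (fun u hu v hv => add_mem_polar hu hv)
      (fun t ht u hu => smul_mem_polar ht hu) hF ?_ ?_ hmR ha (inner_self_sphere a) hpa hτa
      (by rwa [neg_neg]) ?_ (fun u hu => hu p hp) (fun u hu => hu s hs) (inner_self_sphere s)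
      (fun u hu hpu => hm.inner_nonneg_of_edge hR.1 hmR hF ha hpa hτa hu hpu)
      hnR hnτ hnp hsn hy (inner_self_sphere y) hsy (by rwa [neg_neg]) hlt
    · intro u hu v hv huv
      have h1 := hKlow u hu v hv
      rw [real_inner_self_eq_norm_sq, real_inner_self_eq_norm_sq, ← mul_pow, ← mul_pow, ← neg_sq]
      exact pow_le_pow_left₀ (neg_nonneg.2 huv.le) (by linarith) 2
    · intro u hu hmu
      have h1 := hmlow u hu (by rintro rfl; rw [inner_zero_right] at hmu; exact lt_irrefl _ hmu)
      rw [real_inner_self_eq_norm_sq, ← mul_pow, ← neg_sq]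
      exact pow_lt_pow_left₀ (by linarith) (neg_nonneg.2 hmu.le) two_ne_zero
    -- Since `b` is farthest from `a` in the dual body, the first order condition there has normal
    -- `a - κ b = S (S a - κ p)`.
    · intro u hu
      let b : S2 := ⟨κ • (a : E3) + S • (p : E3), by simpa using hunit a p hpa⟩
      have hap : ⟪(a : E3), (p : E3)⟫ = 0 := by rw [real_inner_comm]; exact hpa
      have hab : ⟪(a : E3), (b : E3)⟫ = κ := by
        change ⟪(a : E3), κ • (a : E3) + S • (p : E3)⟫ = κ
        rw [inner_add_right, real_inner_smul_right, real_inner_smul_right, inner_self_sphere, hap]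
        ring
      have h1 := inner_sub_smul_nonneg (k := (a : E3)) (v := b) hb
        (fun w hw => by rw [hab]; exact hmin a w ha hw) hu
      rw [hab] at h1
      change 0 ≤ ⟪u, (a : E3) - κ • (κ • (a : E3) + S • (p : E3))⟫ at h1
      rw [inner_sub_right, real_inner_smul_right, inner_add_right, real_inner_smul_right,
        real_inner_smul_right, real_inner_comm (a : E3) u, real_inner_comm (p : E3) u] at h1
      refine nonneg_of_mul_nonneg_right (a := S) (le_of_le_of_eq h1 ?_) hS
      linear_combination -⟪(a : E3), u⟫ * hS2
  have hy₁ := hside a₁ p₁ τ₁ hF₁ ha₁ hp₁ hτa₁ hpa₁ hb₁ hnτ₁ hnp₁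
  have hy₂ := hside a₂ p₂ τ₂ hF₂ ha₂ hp₂ hτa₂ hpa₂ hb₂ hnτ₂ hnp₂
  -- the case in which the chord passes between the two normals
  set z := κ • (y : E3) + S • (s : E3) with hzdef
  have hz1 : ‖z‖ = 1 := hunit y s hsy
  have hzy : ⟪z, (y : E3)⟫ = κ := by
    rw [hzdef, inner_add_left, real_inner_smul_left, real_inner_smul_left, hsy, inner_self_sphere]
    ring
  have hzp₁ := hz p₁ hp₁
  have hzp₂ := hz p₂ hp₂
  rw [hF₁.inner_eq, hmp₂, zero_mul, zero_add, hwt] at hzp₂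
  rw [hF₁.inner_eq, hF₂.ef, zero_mul, zero_add, hqq] at hy₂
  -- With `p₂ = (q, -t)` and `τ₂ = (t, q)` in the coordinates of `τ₁`, `p₁`, the right side equals
  -- `⟪τ₁, y⟫⟪p₂, z⟫ + ⟪p₁, z⟫⟪τ₂, y⟫`.
  have hcomb : 0 ≤ ⟪τ₁, (p₂ : E3)⟫ *
      (⟪τ₁, z⟫ * ⟪τ₁, (y : E3)⟫ + ⟪(p₁ : E3), z⟫ * ⟪(p₁ : E3), (y : E3)⟫) := by
    have h1 := mul_nonneg hy₁ hzp₂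
    have h2 := mul_nonneg hzp₁ hy₂
    linarith
  have hcomb := nonneg_of_mul_nonneg_right hcomb hq₁
  rw [hF₁.inner_eq] at hzy
  have hmz := hmlow z hz (by rw [← norm_ne_zero_iff, hz1]; exact one_ne_zero)
  rw [hz1, mul_one] at hmz
  have hmz1 : ⟪(m : E3), z⟫ ≤ 1 := by
    have := real_inner_le_norm (m : E3) z
    rwa [hz1, norm_coe_sphere, mul_one] at this
  have hmy := hstrict y hy
  have hmy1 := inner_le_one m y
  have hprod : ⟪(m : E3), z⟫ * ⟪(m : E3), (y : E3)⟫ ≤ κ := by linarith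
  exact hprod.not_gt (lt_mul_of_lt_of_le_one hκ0 hmz hmy hmz1 hmy1)

end SphericalBody

theorem theorem3 (R : Set SphericalBody.S2) (hR : SphericalBody.IsReduced R)
    (m : SphericalBody.S2) (hm : SphericalBody.IsExtremeSupporting R m) :
    SphericalBody.width R m = SphericalBody.thickness R := by
  obtain ⟨p, -, hmp, -⟩ := hm.exists_frame hR.1
  have hmR := hmp.mem_polar
  obtain ⟨y, z, hy, hz, hth, hmin⟩ := SphericalBody.exists_thickness_eq hR.1
  obtain ⟨v, hv, hw, hvmin⟩ := SphericalBody.exists_width_eq hR.1 hmR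
  have hyz : y ≠ z := by
    rintro rfl
    obtain ⟨u, hu, huy⟩ := SphericalBody.exists_ne_mem_polar hR.1 y
    have h1 := hmin u y hu hy
    rw [SphericalBody.inner_self_sphere] at h1
    exact h1.not_gt (SphericalBody.inner_lt_one huy)
  obtain ⟨u, hu, hmu⟩ := hR.exists_inner_le (SphericalBody.neg_one_lt_inner hR.1 hy hz)
    (SphericalBody.inner_lt_one hyz) hth hmin hm
  rw [hw, hth, le_antisymm ((hvmin u hu).trans hmu) (hmin m v hmR hv)]
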